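/- Let $d\ge 2$, $\mathbb{T}^d=(\mathbb{R}/2\pi\mathbb{Z})^d$, $\Lambda=(-\Delta)^{1/2}$ and $\hat f(k)=(2\pi)^{-d}\int_{\mathbb{T}^d}f(x)e^{-ik\cdot x}\,dx$. For $r,\tau\ge 0$ put $$\|\Lambda^r e^{\tau\Lambda}f\|_{L^2}^2:=\sum_{k\in\mathbb{Z}^d\setminus\{0\}}|k|^{2r}e^{2\tau|k|}|\hat f(k)|^2 .$$ A continuous function $f$ on $\mathbb{T}^d$ is called analytic if $\|e^{\tau\Lambda}f\|_{L^2}<\infty$ for some $\tau>0$. Let $T_{ij}$ ($1\le i,j\le d$) be Fourier multiplier operators on $\mathbb{T}^d$ that map real functions to real functions, with symbols satisfying $\widehat{T_{ij}}(0)=0$ and $\sup_{k\ne 0}|\widehat{T_{ij}}(k)|\le C_0<\infty$, and such that $\sum_{i,j}\partial_{x_i}\partial_{x_j}T_{ij}f=0$ for every smooth $f$. Let $\gamma\in(0,2]$ and let $\theta_0,S:\mathbb{T}^d\to\mathbb{R}$ be analytic with mean zero. For $\kappa\ge0$ consider $$\partial_t\theta+u\cdot\nabla\theta=-\kappa\Lambda^\gamma\theta+S(x),\qquad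 u_j=\sum_i\partial_{x_i}T_{ij}\theta,\qquad \theta(\cdot,0)=\theta_0. \tag{$*$}$$ Let $\bar T,\bar\tau>0$, and for every $\kappa\ge0$ let $\theta^\kappa$ be a real-valued mean-zero analytic solution of $(*)$ on $\mathbb{T}^d\times[0,\bar T]$ with radius of analyticity at least $\bar\tau$; that is, $\theta^\kappa(\cdot,t)$ is continuous on $\mathbb{T}^d$ with mean zero for each $t\in[0,\bar T]$, $(*)$ holds at every point of $\mathbb{T}^d\times[0,\bar T]$, and $\sup_{t\in[0,\bar T]}\|e^{\sigma\Lambda}\theta^\kappa(\cdot,t)\|_{L^2}<\infty$ for every $\sigma\in(0,\bar\tau)$ (no uniformity in $\kappa$ is assumed). Then there exist $T\in(0,\bar T]$ and a continuous, strictly decreasing function $\tau:[0,T]\to(0,\bar\tau)$ such that for every $r>\frac d2+\frac52$ and every $t\in[0,T]$, $$\lim_{\kappa\to0^+}\big\|\Lambda^r e^{\tau(t)\Lambda}(\theta^\kappa-\theta^0)(\cdot,t)\big\|_{L^2}=0 .$$ -/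

import Mathlib

open scoped ENNReal NNReal ContDiff

noncomputable section

namespace ActiveScalar

variable {d : ℕ}

/-- The cube `[0, 2π]^d`, a fundamental domain of the torus `𝕋^d = (ℝ / 2πℤ)^d`. -/
def cube (d : ℕ) : Set (Fin d → ℝ) := Set.Icc 0 (fun _ => 2 * Real.pi)

/-- Functions on `𝕋^d` are functions on `ℝ^d` that are `2π`-periodic in every coordinate. -/
def IsPeriodic (f : (Fin d → ℝ) → ℝ) : Prop :=
  ∀ (x : Fin d → ℝ) (n : Fin d → ℤ), f (fun i => x i + 2 * Real.pi * (n i : ℝ)) = f x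

/-- `∫_{𝕋^d} f dx = 0`. -/
def MeanZero (f : (Fin d → ℝ) → ℝ) : Prop := ∫ x in cube d, f x = 0

/-- Euclidean length `|k|` of a frequency `k ∈ ℤ^d`. -/
def freqNorm (k : Fin d → ℤ) : ℝ := Real.sqrt (∑ i, (k i : ℝ) ^ 2)

/-- The character `e^{i k·x}`. -/
def character (k : Fin d → ℤ) (x : Fin d → ℝ) : ℂ :=
  Complex.exp (Complex.I * ((∑ i, (k i : ℝ) * x i : ℝ) : ℂ))

/-- Fourier coefficient `f̂(k) = (2π)^{-d} ∫_{𝕋^d} f(x) e^{-i k·x} dx`. -/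
def coeff (f : (Fin d → ℝ) → ℝ) (k : Fin d → ℤ) : ℂ :=
  (((2 * Real.pi) ^ d : ℝ) : ℂ)⁻¹ * ∫ x in cube d, (f x : ℂ) * character (-k) x

/-- The norm `‖Λ^r e^{τΛ} f‖_{L²} = (∑_{k ≠ 0} |k|^{2r} e^{2τ|k|} |f̂(k)|²)^{1/2} ∈ [0, ∞]`,
where `Λ = (-Δ)^{1/2}`. -/
def analyticNorm (r τ : ℝ) (f : (Fin d → ℝ) → ℝ) : ℝ≥0∞ :=
  (∑' k : {k : Fin d → ℤ // k ≠ 0},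
    ENNReal.ofReal (freqNorm k.1 ^ (2 * r) * Real.exp (2 * τ * freqNorm k.1) *
      ‖coeff f k.1‖ ^ 2)) ^ (1 / 2 : ℝ)

/-- `f` is a real-analytic function on `𝕋^d` (with some positive radius of analyticity). -/
def IsAnalytic (f : (Fin d → ℝ) → ℝ) : Prop :=
  IsPeriodic f ∧ Continuous f ∧ ∃ τ : ℝ, 0 < τ ∧ analyticNorm 0 τ f < ⊤

/-- The Fourier multiplier operator with symbol `m`. All symbols below satisfy
`m(-k) = conj (m(k))`, so that for real `f` the sum is real and `re` loses nothing. -/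
def multiplier (m : (Fin d → ℤ) → ℂ) (f : (Fin d → ℝ) → ℝ) (x : Fin d → ℝ) : ℝ :=
  (∑' k : Fin d → ℤ, m k * coeff f k * character k x).re

/-- `Λ^γ = (-Δ)^{γ/2}`, with symbol `|k|^γ` (used for `γ > 0`). -/
def fracLaplacian (γ : ℝ) (f : (Fin d → ℝ) → ℝ) : (Fin d → ℝ) → ℝ :=
  multiplier (fun k => ((freqNorm k ^ γ : ℝ) : ℂ)) f

/-- Partial derivative `∂_{x_i} f`. -/
def pderiv (i : Fin d) (f : (Fin d → ℝ) → ℝ) (x : Fin d → ℝ) : ℝ :=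
  fderiv ℝ f x (Pi.single i 1)

/-- The velocity `u_j[f] = ∑_i ∂_{x_i} T_{ij} f`, where `T i j` is the symbol of `T_{ij}`. -/
def velocity (T : Fin d → Fin d → (Fin d → ℤ) → ℂ) (f : (Fin d → ℝ) → ℝ)
    (j : Fin d) (x : Fin d → ℝ) : ℝ :=
  ∑ i, pderiv i (multiplier (T i j) f) x

/-- Admissible symbols of the operators `T_{ij}` (at `ν = 0`). -/
structure IsAdmissible (T : Fin d → Fin d → (Fin d → ℤ) → ℂ) : Prop where
  /-- each `T_{ij}` maps real-valued functions to real-valued functions -/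
  real : ∀ i j k, T i j (-k) = (starRingEnd ℂ) (T i j k)
  /-- `∂_{x_i} ∂_{x_j} T_{ij} f = 0` (summed over `i, j`) for smooth `f` on `𝕋^d` -/
  divFree : ∀ f : (Fin d → ℝ) → ℝ, IsPeriodic f → ContDiff ℝ ∞ f →
    ∀ x, ∑ i, ∑ j, pderiv i (pderiv j (multiplier (T i j) f)) x = 0
  zero : ∀ i j, T i j 0 = 0
  bounded : ∃ C₀ : ℝ, 0 < C₀ ∧ ∀ i j k, k ≠ 0 → ‖T i j k‖ ≤ C₀

/-- `θ` is a (mean-zero) analytic solution on `𝕋^d × [0, Tbar]`, with radius of analyticity at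
least `τbar`, of
`∂_t θ + u[θ] · ∇θ = -κ Λ^γ θ + S`, `u_j[θ] = ∑_i ∂_{x_i} T_{ij} θ`, `θ(·, 0) = θ₀`. -/
structure IsAnalyticSolution (T : Fin d → Fin d → (Fin d → ℤ) → ℂ) (γ κ : ℝ)
    (θ₀ S : (Fin d → ℝ) → ℝ) (Tbar τbar : ℝ) (θ : ℝ → (Fin d → ℝ) → ℝ) : Prop where
  periodic : ∀ t ∈ Set.Icc 0 Tbar, IsPeriodic (θ t)
  continuous : ∀ t ∈ Set.Icc 0 Tbar, Continuous (θ t)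
  meanZero : ∀ t ∈ Set.Icc 0 Tbar, MeanZero (θ t)
  /-- Radius at least `τbar`: `‖e^{σΛ} θ(t)‖_{L²}` is bounded on `[0, Tbar]` for every
  `σ < τbar`. The bound may depend on the solution, in particular on `κ`. -/
  radius : ∀ σ : ℝ, 0 < σ → σ < τbar →
    ∃ M : ℝ≥0, ∀ t ∈ Set.Icc 0 Tbar, analyticNorm 0 σ (θ t) ≤ M
  initial : ∀ x, θ 0 x = θ₀ x
  equation : ∀ t ∈ Set.Icc 0 Tbar, ∀ x,
    HasDerivWithinAt (fun s => θ s x)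
      (-(∑ j, velocity T (θ t) j x * pderiv j (θ t) x) - κ * fracLaplacian γ (θ t) x + S x)
      (Set.Icc 0 Tbar) t

end ActiveScalar

end

/-!
The difference `φ = θ^κ - θ^0` is estimated in the Wiener norm
`wienerNorm s τ c = ∑_k |k|^s e^{τ|k|} |c_k|` of its Fourier coefficients, with a radius
`τ₀ - λ t` that shrinks linearly in time. In Fourier variables
`φ_k' = F_k - κ |k|^γ φ_k`, where `F` collects `u[φ] · ∇φ`, `u[φ] · ∇θ^0`, `u[θ^0] · ∇φ` and
`κ Λ^γ θ^0`. The dissipation only helps and `φ` vanishes initially, so differentiating the weight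
gives (`weighted_mode_estimate`, summed over `k`)

`‖φ(t)‖_1 + λ ∫₀ᵗ ‖φ‖_2 ≤ ∫₀ᵗ ‖F‖_1`,

with `‖·‖_s` the Wiener norm with exponent `s` at the current radius. Since `|k| ≤ |m| + |k - m|`,
each product in `F` puts at most two derivatives on a single factor
(`tsum_weight_mul_derivConv_le`), whence
`‖F‖_1 ≤ C (2 ‖φ‖_1 + 4 ‖θ^0‖_2) ‖φ‖_2 + κ ‖θ^0‖_{1+γ}`. If `‖φ‖_1 ≤ 1` and
`λ = C (2 + 4 B)` with `B ≥ sup_t ‖θ^0‖_2`, the first term is absorbed by the left-hand side and,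
for `A ≥ sup_t ‖θ^0‖_{1+γ}`, `‖φ(t)‖_1 ≤ κ A t` remains (`wienerNorm_sub_le_of_le_one`). For
`κ A t₁ < 1` the smallness assumption propagates by continuity in time (`wienerNorm_sub_le`). The constants `λ`, `A`, `t₁`
do not depend on `κ`; the non-uniform bounds on `θ^κ` serve just to make the sums and integrals
finite and continuous. Giving up a further fixed amount of analyticity radius turns the Wiener
bound into all the norms `‖Λ^r e^{τΛ} φ‖` (`analyticNorm_le_of_wienerNorm_le`).

The system of ordinary differential equations for the Fourier coefficients
(`IsAnalyticSolution.hasDerivAt_coeff`) comes from differentiating under the integral sign, once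
the right-hand side of the equation has been written as a combination of products of absolutely
convergent Fourier series. The two derivatives lost in the nonlinearity are recovered from the
shrinking radius alone.
-/

noncomputable section

namespace ActiveScalar

variable {d : ℕ}

open MeasureTheory Topology

open scoped Pointwise

/-! ### Frequencies and exponentially weighted lattice sums -/

lemma freqNorm_eq_norm (k : Fin d → ℤ) :
    freqNorm k = ‖WithLp.toLp 2 (fun i => (k i : ℝ))‖ := by
  simp [freqNorm, EuclideanSpace.norm_eq]

lemma freqNorm_nonneg (k : Fin d → ℤ) : 0 ≤ freqNorm k := Real.sqrt_nonneg _

lemma freqNorm_zero : freqNorm (0 : Fin d → ℤ) = 0 := by simp [freqNorm]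

lemma freqNorm_add_le (k l : Fin d → ℤ) : freqNorm (k + l) ≤ freqNorm k + freqNorm l := by
  simp only [freqNorm_eq_norm]
  refine le_trans (le_of_eq ?_) (norm_add_le _ _)
  congr 1
  ext i
  simp

lemma freqNorm_le_add_sub (k m : Fin d → ℤ) : freqNorm k ≤ freqNorm m + freqNorm (k - m) := by
  simpa using freqNorm_add_le m (k - m)

lemma abs_le_freqNorm (k : Fin d → ℤ) (i : Fin d) : |(k i : ℝ)| ≤ freqNorm k := by
  rw [freqNorm, ← Real.sqrt_sq_eq_abs]
  exact Real.sqrt_le_sqrt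
    (Finset.single_le_sum (f := fun i => (k i : ℝ) ^ 2) (fun i _ => sq_nonneg _)
      (Finset.mem_univ i))

lemma one_le_freqNorm {k : Fin d → ℤ} (hk : k ≠ 0) : 1 ≤ freqNorm k := by
  obtain ⟨i, hi⟩ := Function.ne_iff.mp hk
  refine le_trans ?_ (abs_le_freqNorm k i)
  exact_mod_cast Int.one_le_abs hi

lemma summable_int_exp_neg {c : ℝ} (hc : 0 < c) :
    Summable fun n : ℤ => Real.exp (-c * |(n : ℝ)|) := by
  have h : Summable fun n : ℕ => Real.exp (-c * (n : ℝ)) := by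
    have := summable_geometric_of_lt_one (Real.exp_pos (-c)).le
      (Real.exp_lt_one_iff.mpr (by linarith))
    refine this.congr fun n => ?_
    rw [← Real.exp_nat_mul, mul_comm]
  refine Summable.of_nat_of_neg ?_ ?_
  · simpa using h
  · simpa using h

lemma summable_exp_neg_freqNorm {δ : ℝ} (hδ : 0 < δ) :
    Summable fun k : Fin d → ℤ => Real.exp (-δ * freqNorm k) := by
  classical
  set c : ℝ := δ / (d + 1) with hc
  have hc0 : 0 < c := by positivity
  have hs := summable_int_exp_neg hc0
  have hle : ∀ k : Fin d → ℤ,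
      Real.exp (-δ * freqNorm k) ≤ ∏ i, Real.exp (-c * |(k i : ℝ)|) := by
    intro k
    rw [← Real.exp_sum, Real.exp_le_exp, ← Finset.mul_sum]
    have h1 : ∑ i, |(k i : ℝ)| ≤ d * freqNorm k := by
      refine (Finset.sum_le_sum fun i _ => abs_le_freqNorm k i).trans (le_of_eq ?_)
      simp
    have h2 : c * ∑ i, |(k i : ℝ)| ≤ c * (d * freqNorm k) := by gcongr
    have h3 : c * (d + 1) = δ := by rw [hc]; field_simp
    have h4 := mul_nonneg hc0.le (freqNorm_nonneg k)
    nlinarith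
  refine Summable.of_nonneg_of_le (fun _ => (Real.exp_pos _).le) hle ?_
  refine summable_of_sum_le (c := ∏ _i : Fin d, ∑' n : ℤ, Real.exp (-c * |(n : ℝ)|))
    (fun k => Finset.prod_nonneg fun i _ => (Real.exp_pos _).le) fun s => ?_
  -- A finite set of frequencies lies in a box, over which the sum factorises.
  calc ∑ k ∈ s, ∏ i, Real.exp (-c * |(k i : ℝ)|)
      ≤ ∑ k ∈ Fintype.piFinset fun i => s.image fun k : Fin d → ℤ => k i,
          ∏ i, Real.exp (-c * |(k i : ℝ)|) := by
        refine Finset.sum_le_sum_of_subset_of_nonneg (fun k hk => ?_)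
          fun k _ _ => Finset.prod_nonneg fun i _ => (Real.exp_pos _).le
        rw [Fintype.mem_piFinset]
        exact fun i => Finset.mem_image_of_mem _ hk
    _ = ∏ i, ∑ n ∈ s.image fun k : Fin d → ℤ => k i, Real.exp (-c * |(n : ℝ)|) := by
        rw [Finset.prod_univ_sum]
    _ ≤ _ := Finset.prod_le_prod
        (fun i _ => Finset.sum_nonneg fun _ _ => (Real.exp_pos _).le)
        fun i _ => hs.sum_le_tsum _ fun _ _ => (Real.exp_pos _).le

/-- Powers are absorbed by an arbitrarily slow exponential. -/
lemma exists_rpow_le_mul_exp {s ε : ℝ} (hs : 0 ≤ s) (hε : 0 < ε) :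
    ∃ C : ℝ, 0 < C ∧ ∀ x : ℝ, 0 ≤ x → x ^ s ≤ C * Real.exp (ε * x) := by
  rcases hs.eq_or_lt with rfl | hs
  · exact ⟨1, one_pos, fun x hx => by simpa using mul_nonneg hε.le hx⟩
  · refine ⟨(s / ε) ^ s, by positivity, fun x hx => ?_⟩
    have h1 : x = s / ε * (ε * x / s) := by field_simp
    have h2 : ε * x / s ≤ Real.exp (ε * x / s) := by linarith [Real.add_one_le_exp (ε * x / s)]
    calc x ^ s = (s / ε) ^ s * (ε * x / s) ^ s := by
          conv_lhs => rw [h1]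
          rw [Real.mul_rpow (by positivity) (by positivity)]
      _ ≤ (s / ε) ^ s * Real.exp (ε * x / s) ^ s := by gcongr
      _ = _ := by
          rw [← Real.exp_mul]
          congr 2
          field_simp

lemma summable_rpow_mul_exp_neg {s δ : ℝ} (hs : 0 ≤ s) (hδ : 0 < δ) :
    Summable fun k : Fin d → ℤ => freqNorm k ^ s * Real.exp (-δ * freqNorm k) := by
  obtain ⟨C, hC, h⟩ := exists_rpow_le_mul_exp hs (half_pos hδ)
  refine Summable.of_nonneg_of_le
    (fun k => mul_nonneg (Real.rpow_nonneg (freqNorm_nonneg k) _) (Real.exp_pos _).le)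
    (fun k => ?_) ((summable_exp_neg_freqNorm (d := d) (half_pos hδ)).mul_left C)
  calc freqNorm k ^ s * Real.exp (-δ * freqNorm k)
      ≤ C * Real.exp (δ / 2 * freqNorm k) * Real.exp (-δ * freqNorm k) := by
        gcongr
        exact h _ (freqNorm_nonneg k)
    _ = C * Real.exp (-(δ / 2) * freqNorm k) := by
        rw [mul_assoc, ← Real.exp_add]
        congr 2
        ring

/-! ### Fourier series on the torus -/

/-- Fourier coefficients of a complex-valued function; `coeff f` is the case of a real `f`. -/
def complexCoeff (g : (Fin d → ℝ) → ℂ) (k : Fin d → ℤ) : ℂ :=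
  (((2 * Real.pi) ^ d : ℝ) : ℂ)⁻¹ * ∫ x in cube d, g x * character (-k) x

/-- The function `x ↦ ∑_k c_k e^{ik·x}` with prescribed coefficients. -/
def fourierSeries (c : (Fin d → ℤ) → ℂ) (x : Fin d → ℝ) : ℂ := ∑' k, c k * character k x

lemma coeff_eq_complexCoeff (f : (Fin d → ℝ) → ℝ) (k : Fin d → ℤ) :
    coeff f k = complexCoeff (fun x => (f x : ℂ)) k := rfl

lemma character_add (k l : Fin d → ℤ) (x : Fin d → ℝ) :
    character (k + l) x = character k x * character l x := by
  simp only [character, ← Complex.exp_add]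
  congr 1
  rw [← mul_add, ← Complex.ofReal_add, ← Finset.sum_add_distrib]
  congr 3
  ext i
  simp only [Pi.add_apply, Int.cast_add]
  ring

lemma character_neg (k : Fin d → ℤ) (x : Fin d → ℝ) :
    character (-k) x = (starRingEnd ℂ) (character k x) := by
  simp only [character, ← Complex.exp_conj, map_mul, Complex.conj_I, Complex.conj_ofReal]
  simp

@[simp] lemma norm_character (k : Fin d → ℤ) (x : Fin d → ℝ) : ‖character k x‖ = 1 := by
  rw [character, mul_comm, Complex.norm_exp_ofReal_mul_I]

lemma continuous_character (k : Fin d → ℤ) : Continuous (character k) := by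
  unfold character
  fun_prop

lemma character_zero (x : Fin d → ℝ) : character 0 x = 1 := by simp [character]

lemma isCompact_cube : IsCompact (cube d) := isCompact_Icc

lemma integrableOn_cube {E : Type*} [NormedAddCommGroup E] {g : (Fin d → ℝ) → E}
    (hg : Continuous g) : IntegrableOn g (cube d) :=
  hg.continuousOn.integrableOn_compact isCompact_cube

lemma cube_eq_pi : cube d = Set.univ.pi fun _ => Set.Icc 0 (2 * Real.pi) := by
  rw [cube, ← Set.pi_univ_Icc]; rfl

lemma volume_real_cube : (volume : Measure (Fin d → ℝ)).real (cube d) = (2 * Real.pi) ^ d := by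
  rw [Measure.real, cube, Real.volume_Icc_pi_toReal fun _ => by positivity]
  simp

lemma integral_exp_int {n : ℤ} (hn : n ≠ 0) :
    ∫ x in Set.Icc 0 (2 * Real.pi), Complex.exp (Complex.I * ((n : ℝ) * x : ℝ)) = 0 := by
  rw [integral_Icc_eq_integral_Ioc, ← intervalIntegral.integral_of_le (by positivity)]
  have hc : Complex.I * n ≠ 0 := mul_ne_zero Complex.I_ne_zero (by exact_mod_cast hn)
  have h := integral_exp_mul_complex (a := 0) (b := 2 * Real.pi) hc
  have e : ∀ x : ℝ, Complex.exp (Complex.I * ((n : ℝ) * x : ℝ)) =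
      Complex.exp (Complex.I * n * x) := fun x => by push_cast; ring_nf
  simp_rw [e, h]
  have : Complex.exp (Complex.I * n * (2 * Real.pi : ℝ)) = 1 := by
    rw [Complex.exp_eq_one_iff]
    exact ⟨n, by push_cast; ring⟩
  rw [this]
  simp

lemma integral_character {k : Fin d → ℤ} (hk : k ≠ 0) : ∫ x in cube d, character k x = 0 := by
  obtain ⟨i, hi⟩ := Function.ne_iff.mp hk
  have h : ∀ x : Fin d → ℝ, character k x =
      ∏ i, Complex.exp (Complex.I * ((k i : ℝ) * x i : ℝ)) := fun x => by
    rw [character, ← Complex.exp_sum, Complex.ofReal_sum, Finset.mul_sum]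
  simp_rw [h]
  rw [cube_eq_pi, volume_pi, Measure.restrict_pi_pi,
    integral_fintype_prod_eq_prod (fun i (x : ℝ) => Complex.exp (Complex.I * ((k i : ℝ) * x : ℝ)))]
  exact Finset.prod_eq_zero (Finset.mem_univ i) (integral_exp_int hi)

lemma complexCoeff_character_mul (m k : Fin d → ℤ) (g : (Fin d → ℝ) → ℂ) :
    complexCoeff (fun x => character m x * g x) k = complexCoeff g (k - m) := by
  unfold complexCoeff
  congr 2
  ext x
  rw [show -(k - m) = -k + m by abel, character_add]
  ring

lemma complexCoeff_const_mul (c : ℂ) (g : (Fin d → ℝ) → ℂ) (k : Fin d → ℤ) :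
    complexCoeff (fun x => c * g x) k = c * complexCoeff g k := by
  unfold complexCoeff
  simp_rw [mul_assoc c, integral_const_mul]
  ring

lemma complexCoeff_character (m k : Fin d → ℤ) :
    complexCoeff (character m) k = if m = k then 1 else 0 := by
  have h := complexCoeff_character_mul m k (fun _ => 1)
  simp only [mul_one] at h
  rw [show character m = fun x => character m x from rfl, h]
  unfold complexCoeff
  split_ifs with hmk
  · subst hmk
    have : ((2 * Real.pi) ^ d : ℝ) ≠ 0 := by positivity
    simp only [sub_self, neg_zero, character_zero, setIntegral_const, volume_real_cube,
      Complex.real_smul, mul_one]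
    exact inv_mul_cancel₀ (by exact_mod_cast this)
  · simp only [one_mul]
    rw [integral_character (neg_ne_zero.mpr (sub_ne_zero.mpr (Ne.symm hmk))), mul_zero]

lemma complexCoeff_add {g h : (Fin d → ℝ) → ℂ} (hg : Continuous g) (hh : Continuous h)
    (k : Fin d → ℤ) :
    complexCoeff (fun x => g x + h x) k = complexCoeff g k + complexCoeff h k := by
  unfold complexCoeff
  simp_rw [add_mul]
  have h1 : IntegrableOn (fun x => g x * character (-k) x) (cube d) :=
    integrableOn_cube (hg.mul (continuous_character _))
  have h2 : IntegrableOn (fun x => h x * character (-k) x) (cube d) :=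
    integrableOn_cube (hh.mul (continuous_character _))
  rw [integral_add h1 h2, mul_add]

lemma complexCoeff_sum {ι : Type*} (s : Finset ι) {g : ι → (Fin d → ℝ) → ℂ}
    (hg : ∀ i, Continuous (g i)) (k : Fin d → ℤ) :
    complexCoeff (fun x => ∑ i ∈ s, g i x) k = ∑ i ∈ s, complexCoeff (g i) k := by
  unfold complexCoeff
  simp_rw [Finset.sum_mul]
  have h1 : ∀ i ∈ s, IntegrableOn (fun x => g i x * character (-k) x) (cube d) := fun i _ =>
    integrableOn_cube ((hg i).mul (continuous_character _))
  rw [integral_finsetSum _ h1, Finset.mul_sum]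

/-- Fourier coefficients may be computed term by term in a uniformly summable series. -/
lemma complexCoeff_tsum {g : (Fin d → ℤ) → (Fin d → ℝ) → ℂ} (hg : ∀ m, Continuous (g m))
    {u : (Fin d → ℤ) → ℝ} (hu : Summable u) (hb : ∀ m x, ‖g m x‖ ≤ u m) (k : Fin d → ℤ) :
    complexCoeff (fun x => ∑' m, g m x) k = ∑' m, complexCoeff (g m) k := by
  unfold complexCoeff
  rw [tsum_mul_left]
  congr 1
  have hint : ∀ m, IntegrableOn (fun x => g m x * character (-k) x) (cube d) := fun m =>
    integrableOn_cube ((hg m).mul (continuous_character _))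
  have e := integral_tsum_of_summable_integral_norm hint ?_
  · rw [e]
    simp_rw [tsum_mul_right]
  · refine Summable.of_nonneg_of_le (fun m => integral_nonneg fun _ => norm_nonneg _)
      (fun m => ?_) (hu.mul_left ((2 * Real.pi) ^ d))
    refine (Real.le_norm_self _).trans ?_
    refine (norm_setIntegral_le_of_norm_le_const (C := u m) isCompact_cube.measure_lt_top
      fun x _ => ?_).trans ?_
    · simpa using hb m x
    · rw [volume_real_cube, mul_comm]

lemma norm_mul_character_le (c : (Fin d → ℤ) → ℂ) (k : Fin d → ℤ) (x : Fin d → ℝ) :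
    ‖c k * character k x‖ ≤ ‖c k‖ := by simp

lemma summable_mul_character {c : (Fin d → ℤ) → ℂ} (hc : Summable fun k => ‖c k‖)
    (x : Fin d → ℝ) : Summable fun k => c k * character k x :=
  Summable.of_norm_bounded hc fun k => norm_mul_character_le c k x

lemma continuous_fourierSeries {c : (Fin d → ℤ) → ℂ} (hc : Summable fun k => ‖c k‖) :
    Continuous (fourierSeries c) :=
  continuous_tsum (fun k => continuous_const.mul (continuous_character k)) hc
    fun k x => norm_mul_character_le c k x

lemma norm_fourierSeries_le {c : (Fin d → ℤ) → ℂ} (hc : Summable fun k => ‖c k‖)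
    (x : Fin d → ℝ) : ‖fourierSeries c x‖ ≤ ∑' k, ‖c k‖ :=
  tsum_of_norm_bounded hc.hasSum fun k => norm_mul_character_le c k x

lemma complexCoeff_fourierSeries {c : (Fin d → ℤ) → ℂ} (hc : Summable fun k => ‖c k‖)
    (k : Fin d → ℤ) : complexCoeff (fourierSeries c) k = c k := by
  have h := complexCoeff_tsum (g := fun m x => c m * character m x)
    (fun m => continuous_const.mul (continuous_character m)) hc
    (fun m x => norm_mul_character_le c m x) k
  rw [show fourierSeries c = fun x => ∑' m, c m * character m x from rfl, h,
    tsum_eq_single k]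
  · rw [complexCoeff_const_mul, complexCoeff_character, if_pos rfl, mul_one]
  · intro m hm
    rw [complexCoeff_const_mul, complexCoeff_character, if_neg hm, mul_zero]

/-- The Fourier coefficients of a product are given by a convolution. -/
lemma complexCoeff_fourierSeries_mul {a b : (Fin d → ℤ) → ℂ} (ha : Summable fun k => ‖a k‖)
    (hb : Summable fun k => ‖b k‖) (k : Fin d → ℤ) :
    complexCoeff (fun x => fourierSeries a x * fourierSeries b x) k =
      ∑' m, a m * b (k - m) := by
  have h := complexCoeff_tsum (g := fun m x => a m * (character m x * fourierSeries b x))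
    (fun m => continuous_const.mul ((continuous_character m).mul (continuous_fourierSeries hb)))
    (u := fun m => ‖a m‖ * ∑' k, ‖b k‖) (ha.mul_right _)
    (fun m x => by
      rw [norm_mul, norm_mul, norm_character, one_mul]
      gcongr
      exact norm_fourierSeries_le hb x) k
  have e : (fun x => fourierSeries a x * fourierSeries b x) =
      fun x => ∑' m, a m * (character m x * fourierSeries b x) := by
    ext x
    rw [fourierSeries, ← tsum_mul_right]
    simp_rw [mul_assoc]
  rw [e, h]
  refine tsum_congr fun m => ?_
  rw [complexCoeff_const_mul, complexCoeff_character_mul, complexCoeff_fourierSeries hb]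

/-- A series with Hermitian coefficients is real. -/
lemma fourierSeries_eq_ofReal_re {c : (Fin d → ℤ) → ℂ}
    (hc : ∀ k, c (-k) = (starRingEnd ℂ) (c k)) (x : Fin d → ℝ) :
    ((fourierSeries c x).re : ℂ) = fourierSeries c x := by
  rw [← Complex.conj_eq_iff_re, fourierSeries, Complex.conj_tsum,
    ← (Equiv.neg (Fin d → ℤ)).tsum_eq]
  refine tsum_congr fun k => ?_
  rw [Equiv.neg_apply, map_mul, hc, character_neg, Complex.conj_conj, Complex.conj_conj]

lemma coeff_neg (f : (Fin d → ℝ) → ℝ) (k : Fin d → ℤ) :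
    coeff f (-k) = (starRingEnd ℂ) (coeff f k) := by
  unfold coeff
  rw [map_mul, ← integral_conj, map_inv₀, Complex.conj_ofReal]
  simp_rw [map_mul, Complex.conj_ofReal, ← character_neg]

lemma norm_coeff_le_of_bound {f : (Fin d → ℝ) → ℝ} {C : ℝ} (hf : ∀ x ∈ cube d, |f x| ≤ C)
    (k : Fin d → ℤ) : ‖coeff f k‖ ≤ C := by
  have hpos : (0 : ℝ) < (2 * Real.pi) ^ d := by positivity
  have h := norm_setIntegral_le_of_norm_le_const (C := C)
    (f := fun x => (f x : ℂ) * character (-k) x) (μ := volume) (s := cube d)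
    isCompact_cube.measure_lt_top fun x hx => by simpa using hf x hx
  rw [volume_real_cube] at h
  rw [coeff, norm_mul, norm_inv, Complex.norm_real, Real.norm_of_nonneg hpos.le,
    inv_mul_le_iff₀ hpos, mul_comm]
  exact h

lemma coeff_sub {f g : (Fin d → ℝ) → ℝ} (hf : Continuous f) (hg : Continuous g)
    (k : Fin d → ℤ) : coeff (fun x => f x - g x) k = coeff f k - coeff g k := by
  have h := complexCoeff_add (g := fun x => (f x : ℂ)) (h := fun x => (-1 : ℂ) * (g x : ℂ))
    (by fun_prop) (by fun_prop) k
  rw [complexCoeff_const_mul] at h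
  rw [coeff_eq_complexCoeff, coeff_eq_complexCoeff, coeff_eq_complexCoeff]
  simpa [sub_eq_add_neg] using h

lemma coeff_zero_of_meanZero {f : (Fin d → ℝ) → ℝ} (hf : MeanZero f) : coeff f 0 = 0 := by
  unfold coeff
  simp only [neg_zero, character_zero, mul_one]
  rw [integral_complex_ofReal, show ∫ x in cube d, f x = 0 from hf]
  simp

/-- Differentiation of a Fourier series. -/
lemma pderiv_fourierSeries {c : (Fin d → ℤ) → ℂ}
    (hc : Summable fun k => freqNorm k * ‖c k‖) (hc' : Summable fun k => ‖c k‖)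
    (i : Fin d) (x : Fin d → ℝ) :
    pderiv i (fun y => (fourierSeries c y).re) x =
      (fourierSeries (fun k => Complex.I * (k i : ℂ) * c k) x).re := by
  let L : (Fin d → ℤ) → (Fin d → ℝ) →L[ℝ] ℂ := fun k =>
    ∑ i, (k i : ℝ) • Complex.ofRealCLM.comp (ContinuousLinearMap.proj i)
  have hL : ∀ k y, L k y = ((∑ i, (k i : ℝ) * y i : ℝ) : ℂ) := fun k y => by simp [L]
  have hLn : ∀ k, ‖L k‖ ≤ d * freqNorm k := fun k => by
    refine ContinuousLinearMap.opNorm_le_bound _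
      (mul_nonneg (Nat.cast_nonneg _) (freqNorm_nonneg k)) fun y => ?_
    rw [hL, Complex.norm_real, Real.norm_eq_abs]
    refine (Finset.abs_sum_le_sum_abs _ _).trans ?_
    refine (Finset.sum_le_sum (g := fun _ => freqNorm k * ‖y‖) fun i _ => ?_).trans ?_
    · rw [abs_mul]
      exact mul_le_mul (abs_le_freqNorm k i) (norm_le_pi_norm y i) (abs_nonneg _)
        (freqNorm_nonneg k)
    · simp [mul_assoc]
  have hd : ∀ k y, HasFDerivAt (fun z => c k * character k z)
      ((c k * (character k y * Complex.I)) • L k) y := fun k y => by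
    have h1 : HasFDerivAt (fun z => Complex.I * L k z) (Complex.I • L k) y :=
      (L k).hasFDerivAt.const_mul Complex.I
    have h2 := (h1.cexp).const_mul (c k)
    have e : (fun z => c k * character k z) = fun z => c k * Complex.exp (Complex.I * L k z) := by
      ext z; rw [hL, character]
    rw [e]
    refine h2.congr_fderiv ?_
    rw [smul_smul, smul_smul, hL, character, mul_assoc]
  have hsum : HasFDerivAt (fourierSeries c)
      (∑' k, (c k * (character k x * Complex.I)) • L k) x := by
    refine hasFDerivAt_tsum (u := fun k => d * (freqNorm k * ‖c k‖)) (hc.mul_left _) hd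
      (fun k y => ?_) (summable_mul_character hc' x) x
    rw [norm_smul, norm_mul, norm_mul, norm_character, Complex.norm_I]
    nlinarith [hLn k, norm_nonneg (c k), norm_nonneg (L k)]
  have hsummable : Summable fun k => (c k * (character k x * Complex.I)) • L k := by
    refine Summable.of_norm_bounded (g := fun k => d * (freqNorm k * ‖c k‖)) (hc.mul_left _)
      fun k => ?_
    rw [norm_smul, norm_mul, norm_mul, norm_character, Complex.norm_I]
    nlinarith [hLn k, norm_nonneg (c k), norm_nonneg (L k)]
  have hre := Complex.reCLM.hasFDerivAt.comp x hsum
  have hre' : HasFDerivAt (fun y => (fourierSeries c y).re)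
      (Complex.reCLM.comp (∑' k, (c k * (character k x * Complex.I)) • L k)) x := hre
  rw [pderiv, hre'.fderiv, ContinuousLinearMap.comp_apply]
  have happ := ((ContinuousLinearMap.apply ℝ ℂ (Pi.single i (1 : ℝ))).map_tsum hsummable)
  simp only [ContinuousLinearMap.apply_apply] at happ
  rw [happ, Complex.reCLM_apply, fourierSeries]
  congr 1
  refine tsum_congr fun k => ?_
  rw [smul_apply, hL, smul_eq_mul]
  have : ∑ j, (k j : ℝ) * (Pi.single i (1 : ℝ) : Fin d → ℝ) j = k i := by
    simp [Pi.single_apply]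
  rw [this]
  push_cast
  ring

/-- A continuous periodic function with summable Fourier coefficients is the sum of its Fourier
series. -/
lemma ofReal_eq_fourierSeries {f : (Fin d → ℝ) → ℝ} (hp : IsPeriodic f) (hf : Continuous f)
    (hs : Summable fun k => ‖coeff f k‖) (x : Fin d → ℝ) :
    (f x : ℂ) = fourierSeries (coeff f) x := by
  have hpi : (0 : ℝ) < 2 * Real.pi := by positivity
  let q : (Fin d → ℝ) → UnitAddTorus (Fin d) := fun y i => (y i : UnitAddCircle)
  have hq : IsOpenQuotientMap q :=
    IsOpenQuotientMap.piMap (f := fun (_ : Fin d) (y : ℝ) => (y : UnitAddCircle))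
      fun _ => QuotientAddGroup.isOpenQuotientMap_mk
  let g : C(Fin d → ℝ, ℂ) := ⟨fun y => (f ((2 * Real.pi) • y) : ℂ), by fun_prop⟩
  have hg : Function.FactorsThrough g q := by
    intro a b hab
    have h1 : ∀ i, ∃ n : ℤ, b i = a i + n := fun i => by
      have h2 : ((a i : ℝ) : UnitAddCircle) = (b i : ℝ) := congrFun hab i
      obtain ⟨n, hn⟩ := AddSubgroup.mem_zmultiples_iff.mp (QuotientAddGroup.eq.mp h2)
      refine ⟨n, ?_⟩
      simp only [zsmul_eq_mul, mul_one] at hn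
      linarith
    choose n hn using h1
    have h3 := hp ((2 * Real.pi) • a) n
    simp only [g, ContinuousMap.coe_mk, Complex.ofReal_inj]
    rw [← h3]
    congr 1
    ext i
    simp only [Pi.smul_apply, smul_eq_mul, hn]
    ring
  let qc : C(Fin d → ℝ, UnitAddTorus (Fin d)) := ⟨q, hq.continuous⟩
  have hqc : IsQuotientMap qc := hq.isQuotientMap
  let G : C(UnitAddTorus (Fin d), ℂ) := hqc.lift g hg
  have hG : ∀ y, G (q y) = g y := fun y =>
    congrFun (congrArg DFunLike.coe (hqc.lift_comp g hg)) y
  have hchar : ∀ (n : Fin d → ℤ) (y : Fin d → ℝ),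
      UnitAddTorus.mFourier n (q y) = character n ((2 * Real.pi) • y) := fun n y => by
    simp only [UnitAddTorus.mFourier, ContinuousMap.coe_mk, q, fourier_coe_apply, character]
    rw [← Complex.exp_sum, Complex.ofReal_sum, Finset.mul_sum]
    congr 1
    refine Finset.sum_congr rfl fun i _ => ?_
    simp only [Pi.smul_apply, smul_eq_mul]
    push_cast
    ring
  have hset : (2 * Real.pi) • {y : Fin d → ℝ | ∀ i, y i ∈ Set.Ioc (0 : ℝ) (0 + 1)} =
      Set.univ.pi fun _ => Set.Ioc 0 (2 * Real.pi) := by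
    ext y
    rw [Set.mem_smul_set_iff_inv_smul_mem₀ hpi.ne']
    simp only [Set.mem_ofPred_eq, Pi.smul_apply, smul_eq_mul, Set.mem_Ioc, zero_add, Set.mem_pi,
      Set.mem_univ, forall_const]
    refine forall_congr' fun i => and_congr ?_ ?_
    · rw [mul_pos_iff_of_pos_left (inv_pos.mpr hpi)]
    · rw [inv_mul_le_iff₀ hpi, mul_one]
  have hcoeff : ∀ n, UnitAddTorus.mFourierCoeff G n = coeff f n := fun n => by
    rw [UnitAddTorus.mFourierCoeff_eq_integral G n fun _ => 0]
    have e : ∀ y : Fin d → ℝ, UnitAddTorus.mFourier (-n) (fun i => (y i : UnitAddCircle)) •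
        G (fun i => (y i : UnitAddCircle)) =
        (fun z => (f z : ℂ) * character (-n) z) ((2 * Real.pi) • y) := fun y => by
      have h1 := hchar (-n) y
      have h2 := hG y
      simp only [q] at h1 h2
      rw [h1, h2, smul_eq_mul, mul_comm]
      rfl
    have h1 := Measure.setIntegral_comp_smul_of_pos (volume : Measure (Fin d → ℝ))
      (fun z => (f z : ℂ) * character (-n) z)
      {y : Fin d → ℝ | ∀ i, y i ∈ Set.Ioc (0 : ℝ) (0 + 1)} hpi
    refine (integral_congr_ae (ae_of_all _ e)).trans (h1.trans ?_)
    have h2 : (Set.univ.pi fun _ : Fin d => Set.Ioc 0 (2 * Real.pi)) =ᵐ[volume] cube d :=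
      Measure.univ_pi_Ioc_ae_eq_Icc (f := (0 : Fin d → ℝ)) (g := fun _ => 2 * Real.pi)
    rw [hset, coeff, setIntegral_congr_set h2]
    simp [Complex.real_smul]
  have hsum : Summable (UnitAddTorus.mFourierCoeff G) := by
    rw [show UnitAddTorus.mFourierCoeff G = coeff f from funext hcoeff]
    exact hs.of_norm
  have h := UnitAddTorus.hasSum_mFourier_series_apply_of_summable hsum
    (q ((2 * Real.pi)⁻¹ • x))
  simp only [hcoeff, hchar, hG, smul_smul, mul_inv_cancel₀ hpi.ne', one_smul, smul_eq_mul] at h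
  rw [fourierSeries, h.tsum_eq]
  simp only [g, ContinuousMap.coe_mk, smul_smul, mul_inv_cancel₀ hpi.ne', one_smul]

/-! ### The equation on the Fourier side -/

/-- Symbol of the quadratic term `u[f] · ∇g` for a frequency `m` of `f` and a frequency `n`
of `g`. -/
def interaction (T : Fin d → Fin d → (Fin d → ℤ) → ℂ) (m n : Fin d → ℤ) : ℂ :=
  ∑ j, (∑ i, Complex.I * (m i : ℂ) * T i j m) * (Complex.I * (n j : ℂ))

/-- Fourier coefficient at `k` of `u[f] · ∇g`, in terms of the coefficients `a` of `f` and `b`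
of `g`. -/
def transport (T : Fin d → Fin d → (Fin d → ℤ) → ℂ) (a b : (Fin d → ℤ) → ℂ) (k : Fin d → ℤ) : ℂ :=
  ∑' m, interaction T m (k - m) * (a m * b (k - m))

/-- Right-hand side `-u[f] · ∇f - κ Λ^γ f + S` of the evolution equation. -/
def evolutionRHS (T : Fin d → Fin d → (Fin d → ℤ) → ℂ) (γ κ : ℝ) (S f : (Fin d → ℝ) → ℝ)
    (x : Fin d → ℝ) : ℝ :=
  -(∑ j, velocity T f j x * pderiv j f x) - κ * fracLaplacian γ f x + S x

lemma norm_I_mul_intCast_le (k : Fin d → ℤ) (i : Fin d) :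
    ‖Complex.I * (k i : ℂ)‖ ≤ freqNorm k := by
  rw [norm_mul, Complex.norm_I, one_mul, Complex.norm_intCast]
  exact abs_le_freqNorm k i

lemma IsAdmissible.exists_bound {T : Fin d → Fin d → (Fin d → ℤ) → ℂ} (hT : IsAdmissible T) :
    ∃ C₀ : ℝ, 0 < C₀ ∧ ∀ i j k, ‖T i j k‖ ≤ C₀ := by
  obtain ⟨C₀, h0, h⟩ := hT.bounded
  refine ⟨C₀, h0, fun i j k => ?_⟩
  by_cases hk : k = 0
  · rw [hk, hT.zero, norm_zero]
    exact h0.le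
  · exact h i j k hk

lemma norm_velocity_symbol_le {T : Fin d → Fin d → (Fin d → ℤ) → ℂ} {C₀ : ℝ}
    (hC : ∀ i j k, ‖T i j k‖ ≤ C₀) (j : Fin d) (m : Fin d → ℤ) :
    ‖∑ i, Complex.I * (m i : ℂ) * T i j m‖ ≤ d * C₀ * freqNorm m := by
  refine (norm_sum_le_of_le _ (n := fun _ => freqNorm m * C₀) fun i _ => ?_).trans ?_
  · rw [norm_mul]
    exact mul_le_mul (norm_I_mul_intCast_le m i) (hC i j m) (norm_nonneg _) (freqNorm_nonneg m)
  · simp only [Finset.sum_const, Finset.card_univ, Fintype.card_fin, nsmul_eq_mul]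
    exact le_of_eq (by ring)

lemma norm_interaction_le {T : Fin d → Fin d → (Fin d → ℤ) → ℂ} {C₀ : ℝ}
    (hC : ∀ i j k, ‖T i j k‖ ≤ C₀) (m n : Fin d → ℤ) :
    ‖interaction T m n‖ ≤ d * (d * C₀) * (freqNorm m * freqNorm n) := by
  refine (norm_sum_le_of_le _ (n := fun _ => d * C₀ * freqNorm m * freqNorm n)
    fun j _ => ?_).trans ?_
  · rw [norm_mul]
    exact mul_le_mul (norm_velocity_symbol_le hC j m) (norm_I_mul_intCast_le n j) (norm_nonneg _)
      ((norm_nonneg _).trans (norm_velocity_symbol_le hC j m))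
  · simp only [Finset.sum_const, Finset.card_univ, Fintype.card_fin, nsmul_eq_mul]
    exact le_of_eq (by ring)

section Decay

variable {σ M : ℝ} {c : (Fin d → ℤ) → ℂ}

lemma nonneg_of_decay (hc : ∀ k, ‖c k‖ ≤ M * Real.exp (-σ * freqNorm k)) : 0 ≤ M :=
  nonneg_of_mul_nonneg_left ((norm_nonneg _).trans (hc 0)) (Real.exp_pos _)

lemma summable_rpow_mul_of_decay (hσ : 0 < σ) {s : ℝ} (hs : 0 ≤ s)
    (hc : ∀ k, ‖c k‖ ≤ M * Real.exp (-σ * freqNorm k)) :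
    Summable fun k => freqNorm k ^ s * ‖c k‖ := by
  refine Summable.of_nonneg_of_le
    (fun k => mul_nonneg (Real.rpow_nonneg (freqNorm_nonneg k) _) (norm_nonneg _)) (fun k => ?_)
    ((summable_rpow_mul_exp_neg (d := d) hs hσ).mul_left M)
  calc freqNorm k ^ s * ‖c k‖ ≤ freqNorm k ^ s * (M * Real.exp (-σ * freqNorm k)) :=
        mul_le_mul_of_nonneg_left (hc k) (Real.rpow_nonneg (freqNorm_nonneg k) _)
    _ = _ := by ring

lemma tsum_rpow_mul_le_of_decay (hσ : 0 < σ) {s : ℝ} (hs : 0 ≤ s)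
    (hc : ∀ k, ‖c k‖ ≤ M * Real.exp (-σ * freqNorm k)) :
    ∑' k, freqNorm k ^ s * ‖c k‖ ≤
      M * ∑' k : Fin d → ℤ, freqNorm k ^ s * Real.exp (-σ * freqNorm k) := by
  rw [← tsum_mul_left]
  refine (summable_rpow_mul_of_decay hσ hs hc).tsum_le_tsum (fun k => ?_)
    ((summable_rpow_mul_exp_neg (d := d) hs hσ).mul_left M)
  calc freqNorm k ^ s * ‖c k‖ ≤ freqNorm k ^ s * (M * Real.exp (-σ * freqNorm k)) :=
        mul_le_mul_of_nonneg_left (hc k) (Real.rpow_nonneg (freqNorm_nonneg k) _)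
    _ = _ := by ring

/-- A symbol of growth `B |k|^s` applied to exponentially decaying coefficients. -/
lemma summable_norm_of_symbol (hσ : 0 < σ) {s B : ℝ} (hs : 0 ≤ s)
    (hc : ∀ k, ‖c k‖ ≤ M * Real.exp (-σ * freqNorm k)) {p : (Fin d → ℤ) → ℂ}
    (hp : ∀ k, ‖p k‖ ≤ B * freqNorm k ^ s) : Summable fun k => ‖p k * c k‖ := by
  refine Summable.of_nonneg_of_le (fun k => norm_nonneg _) (fun k => ?_)
    ((summable_rpow_mul_of_decay hσ hs hc).mul_left B)
  rw [norm_mul, ← mul_assoc]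
  exact mul_le_mul_of_nonneg_right (hp k) (norm_nonneg _)

lemma tsum_norm_le_of_symbol (hσ : 0 < σ) {s B : ℝ} (hs : 0 ≤ s) (hB : 0 ≤ B)
    (hc : ∀ k, ‖c k‖ ≤ M * Real.exp (-σ * freqNorm k)) {p : (Fin d → ℤ) → ℂ}
    (hp : ∀ k, ‖p k‖ ≤ B * freqNorm k ^ s) :
    ∑' k, ‖p k * c k‖ ≤
      B * (M * ∑' k : Fin d → ℤ, freqNorm k ^ s * Real.exp (-σ * freqNorm k)) := by
  refine le_trans ?_ (mul_le_mul_of_nonneg_left (tsum_rpow_mul_le_of_decay hσ hs hc) hB)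
  rw [← tsum_mul_left]
  refine (summable_norm_of_symbol hσ hs hc hp).tsum_le_tsum (fun k => ?_)
    ((summable_rpow_mul_of_decay hσ hs hc).mul_left B)
  rw [norm_mul, ← mul_assoc]
  exact mul_le_mul_of_nonneg_right (hp k) (norm_nonneg _)

end Decay

section Fields

variable {T : Fin d → Fin d → (Fin d → ℤ) → ℂ} {γ κ σ M C₀ : ℝ} {S f : (Fin d → ℝ) → ℝ}

lemma summable_norm_of_decay {c : (Fin d → ℤ) → ℂ} (hσ : 0 < σ)
    (hc : ∀ k, ‖c k‖ ≤ M * Real.exp (-σ * freqNorm k)) : Summable fun k => ‖c k‖ := by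
  simpa using summable_rpow_mul_of_decay hσ le_rfl hc

lemma pderiv_eq_fourierSeries (hp : IsPeriodic f) (hf : Continuous f) (hσ : 0 < σ)
    (hc : ∀ k, ‖coeff f k‖ ≤ M * Real.exp (-σ * freqNorm k)) (j : Fin d) (x : Fin d → ℝ) :
    (pderiv j f x : ℂ) = fourierSeries (fun k => Complex.I * (k j : ℂ) * coeff f k) x := by
  have h0 := summable_norm_of_decay hσ hc
  have h1 : Summable fun k => freqNorm k * ‖coeff f k‖ := by
    simpa using summable_rpow_mul_of_decay hσ zero_le_one hc
  have e : f = fun y => (fourierSeries (coeff f) y).re := by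
    ext y
    rw [← ofReal_eq_fourierSeries hp hf h0, Complex.ofReal_re]
  conv_lhs => rw [e]
  rw [pderiv_fourierSeries h1 h0, fourierSeries_eq_ofReal_re]
  intro k
  rw [coeff_neg, map_mul, map_mul, Complex.conj_I, map_intCast]
  simp

lemma velocity_eq_fourierSeries (hT : IsAdmissible T) (hC : ∀ i j k, ‖T i j k‖ ≤ C₀)
    (hσ : 0 < σ) (hc : ∀ k, ‖coeff f k‖ ≤ M * Real.exp (-σ * freqNorm k)) (j : Fin d)
    (x : Fin d → ℝ) :
    (velocity T f j x : ℂ) =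
      fourierSeries (fun k => (∑ i, Complex.I * (k i : ℂ) * T i j k) * coeff f k) x := by
  have hb : ∀ i k, ‖T i j k‖ ≤ C₀ * freqNorm k ^ (0 : ℝ) := fun i k => by simpa using hC i j k
  have hM := nonneg_of_decay hc
  have hTc : ∀ i k, ‖T i j k * coeff f k‖ ≤ C₀ * M * Real.exp (-σ * freqNorm k) := fun i k => by
    rw [norm_mul, mul_assoc]
    exact mul_le_mul (hC i j k) (hc k) (norm_nonneg _) ((norm_nonneg _).trans (hC i j k))
  have hpd : ∀ i, (pderiv i (multiplier (T i j) f) x : ℂ) =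
      fourierSeries (fun k => Complex.I * (k i : ℂ) * (T i j k * coeff f k)) x := fun i => by
    have h0 := summable_norm_of_decay hσ (hTc i)
    have h1 : Summable fun k => freqNorm k * ‖T i j k * coeff f k‖ := by
      simpa using summable_rpow_mul_of_decay hσ zero_le_one (hTc i)
    rw [show multiplier (T i j) f =
      fun y => (fourierSeries (fun k => T i j k * coeff f k) y).re from rfl,
      pderiv_fourierSeries h1 h0, fourierSeries_eq_ofReal_re]
    intro k
    rw [coeff_neg, hT.real, map_mul, map_mul, map_mul, Complex.conj_I, map_intCast]
    simp
  have hs : ∀ i, Summable fun k =>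
      Complex.I * (k i : ℂ) * (T i j k * coeff f k) * character k x := fun i =>
    summable_mul_character (summable_norm_of_symbol (B := 1) (s := 1) hσ zero_le_one (hTc i)
      fun k => by simpa using norm_I_mul_intCast_le k i) x
  rw [velocity, Complex.ofReal_sum]
  simp_rw [hpd, fourierSeries]
  rw [← Summable.tsum_finsetSum fun i _ => hs i]
  refine tsum_congr fun k => ?_
  rw [Finset.sum_mul, Finset.sum_mul]
  exact Finset.sum_congr rfl fun i _ => by ring

lemma fracLaplacian_eq_fourierSeries (x : Fin d → ℝ) :
    (fracLaplacian γ f x : ℂ) =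
      fourierSeries (fun k => ((freqNorm k ^ γ : ℝ) : ℂ) * coeff f k) x := by
  rw [show fracLaplacian γ f x =
    (fourierSeries (fun k => ((freqNorm k ^ γ : ℝ) : ℂ) * coeff f k) x).re from rfl,
    fourierSeries_eq_ofReal_re]
  intro k
  rw [coeff_neg, map_mul, Complex.conj_ofReal]
  simp [freqNorm]

/-- For exponentially decaying coefficients, the right-hand side of the equation is a combination
of absolutely convergent Fourier series. -/
lemma evolutionRHS_eq_fourierSeries (hT : IsAdmissible T) (hC : ∀ i j k, ‖T i j k‖ ≤ C₀)
    (hp : IsPeriodic f) (hf : Continuous f) (hσ : 0 < σ)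
    (hc : ∀ k, ‖coeff f k‖ ≤ M * Real.exp (-σ * freqNorm k)) (x : Fin d → ℝ) :
    (evolutionRHS T γ κ S f x : ℂ) =
      (-1 : ℂ) * (∑ j,
        fourierSeries (fun k => (∑ i, Complex.I * (k i : ℂ) * T i j k) * coeff f k) x *
        fourierSeries (fun k => Complex.I * (k j : ℂ) * coeff f k) x) +
      ((-κ : ℂ) * fourierSeries (fun k => ((freqNorm k ^ γ : ℝ) : ℂ) * coeff f k) x + S x) := by
  simp_rw [← velocity_eq_fourierSeries hT hC hσ hc, ← pderiv_eq_fourierSeries hp hf hσ hc,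
    ← fracLaplacian_eq_fourierSeries, evolutionRHS]
  push_cast
  ring

lemma summable_velocity_coeff (hC : ∀ i j k, ‖T i j k‖ ≤ C₀) (hσ : 0 < σ)
    (hc : ∀ k, ‖coeff f k‖ ≤ M * Real.exp (-σ * freqNorm k)) (j : Fin d) :
    Summable fun k => ‖(∑ i, Complex.I * (k i : ℂ) * T i j k) * coeff f k‖ :=
  summable_norm_of_symbol (s := 1) hσ zero_le_one hc fun k => by
    simpa using norm_velocity_symbol_le hC j k

lemma summable_pderiv_coeff (hσ : 0 < σ)
    (hc : ∀ k, ‖coeff f k‖ ≤ M * Real.exp (-σ * freqNorm k)) (j : Fin d) :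
    Summable fun k => ‖Complex.I * (k j : ℂ) * coeff f k‖ :=
  summable_norm_of_symbol (B := 1) (s := 1) hσ zero_le_one hc fun k => by
    simpa using norm_I_mul_intCast_le k j

lemma norm_rpow_freqNorm_le (k : Fin d → ℤ) :
    ‖((freqNorm k ^ γ : ℝ) : ℂ)‖ ≤ 1 * freqNorm k ^ γ := by
  rw [Complex.norm_real, Real.norm_of_nonneg (Real.rpow_nonneg (freqNorm_nonneg k) _), one_mul]

lemma continuous_evolutionRHS (hT : IsAdmissible T) (hC : ∀ i j k, ‖T i j k‖ ≤ C₀)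
    (hγ : 0 ≤ γ) (hS : Continuous S) (hp : IsPeriodic f) (hf : Continuous f) (hσ : 0 < σ)
    (hc : ∀ k, ‖coeff f k‖ ≤ M * Real.exp (-σ * freqNorm k)) :
    Continuous (evolutionRHS T γ κ S f) := by
  have h : Continuous fun x => (evolutionRHS T γ κ S f x : ℂ) := by
    simp_rw [evolutionRHS_eq_fourierSeries hT hC hp hf hσ hc]
    have h1 := fun j => continuous_fourierSeries (summable_velocity_coeff hC hσ hc j)
    have h2 := fun j => continuous_fourierSeries (summable_pderiv_coeff hσ hc j)
    have h3 := continuous_fourierSeries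
      (summable_norm_of_symbol hσ hγ hc (norm_rpow_freqNorm_le (d := d) (γ := γ)))
    fun_prop
  exact Complex.continuous_re.comp h

lemma coeff_evolutionRHS (hT : IsAdmissible T) (hC : ∀ i j k, ‖T i j k‖ ≤ C₀)
    (hγ : 0 ≤ γ) (hS : Continuous S) (hp : IsPeriodic f) (hf : Continuous f) (hσ : 0 < σ)
    (hc : ∀ k, ‖coeff f k‖ ≤ M * Real.exp (-σ * freqNorm k)) (k : Fin d → ℤ) :
    coeff (evolutionRHS T γ κ S f) k =
      -transport T (coeff f) (coeff f) k - κ * (freqNorm k ^ γ : ℝ) * coeff f k + coeff S k := by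
  have s1 := summable_velocity_coeff hC hσ hc
  have s2 := summable_pderiv_coeff hσ hc
  have s3 := summable_norm_of_symbol hσ hγ hc (norm_rpow_freqNorm_le (d := d) (γ := γ))
  have h1 := fun j => continuous_fourierSeries (s1 j)
  have h2 := fun j => continuous_fourierSeries (s2 j)
  have h3 := continuous_fourierSeries s3
  rw [coeff_eq_complexCoeff]
  simp_rw [evolutionRHS_eq_fourierSeries hT hC hp hf hσ hc]
  rw [complexCoeff_add (by fun_prop) (by fun_prop), complexCoeff_const_mul,
    complexCoeff_add (by fun_prop) (by fun_prop), complexCoeff_const_mul,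
    complexCoeff_fourierSeries s3, ← coeff_eq_complexCoeff,
    complexCoeff_sum (g := fun j x =>
      fourierSeries (fun k => (∑ i, Complex.I * (k i : ℂ) * T i j k) * coeff f k) x *
      fourierSeries (fun k => Complex.I * (k j : ℂ) * coeff f k) x) _
      fun j => (h1 j).mul (h2 j)]
  simp_rw [fun j => complexCoeff_fourierSeries_mul (s1 j) (s2 j) k]
  have hsum : ∀ j, Summable fun m => (∑ i, Complex.I * (m i : ℂ) * T i j m) * coeff f m *
      (Complex.I * ((k - m) j : ℂ) * coeff f (k - m)) := fun j => by
    refine Summable.of_norm_bounded (g := fun m =>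
      ‖(∑ i, Complex.I * (m i : ℂ) * T i j m) * coeff f m‖ *
        ∑' k, ‖Complex.I * (k j : ℂ) * coeff f k‖) ((s1 j).mul_right _) fun m => ?_
    rw [norm_mul]
    exact mul_le_mul_of_nonneg_left ((s2 j).le_tsum (k - m) fun _ _ => norm_nonneg _)
      (norm_nonneg _)
  rw [← Summable.tsum_finsetSum fun j _ => hsum j, transport]
  have e : ∀ m, ∑ j, (∑ i, Complex.I * (m i : ℂ) * T i j m) * coeff f m *
      (Complex.I * ((k - m) j : ℂ) * coeff f (k - m)) =
      interaction T m (k - m) * (coeff f m * coeff f (k - m)) := fun m => by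
    rw [interaction, Finset.sum_mul]
    exact Finset.sum_congr rfl fun j _ => by ring
  simp_rw [e]
  ring

/-- A bound on the right-hand side that depends on `f` only through the decay of its
coefficients. -/
lemma abs_evolutionRHS_le (hT : IsAdmissible T) (hC₀ : 0 ≤ C₀) (hC : ∀ i j k, ‖T i j k‖ ≤ C₀)
    (hγ : 0 ≤ γ) (hκ : 0 ≤ κ) (hp : IsPeriodic f) (hf : Continuous f) (hσ : 0 < σ)
    (hc : ∀ k, ‖coeff f k‖ ≤ M * Real.exp (-σ * freqNorm k)) (x : Fin d → ℝ) :
    |evolutionRHS T γ κ S f x| ≤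
      d * ((d * C₀ * (M * ∑' k : Fin d → ℤ, freqNorm k ^ (1 : ℝ) * Real.exp (-σ * freqNorm k))) *
        (1 * (M * ∑' k : Fin d → ℤ, freqNorm k ^ (1 : ℝ) * Real.exp (-σ * freqNorm k)))) +
      κ * (1 * (M * ∑' k : Fin d → ℤ, freqNorm k ^ γ * Real.exp (-σ * freqNorm k))) + |S x| := by
  have b1 := fun j => (norm_fourierSeries_le (summable_velocity_coeff hC hσ hc j) x).trans
    (tsum_norm_le_of_symbol (s := 1) (B := d * C₀) hσ zero_le_one (by positivity) hc fun k => by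
      simpa using norm_velocity_symbol_le hC j k)
  have b2 := fun j => (norm_fourierSeries_le (summable_pderiv_coeff hσ hc j) x).trans
    (tsum_norm_le_of_symbol (s := 1) (B := 1) hσ zero_le_one zero_le_one hc fun k => by
      simpa using norm_I_mul_intCast_le k j)
  have b3 := (norm_fourierSeries_le (summable_norm_of_symbol hσ hγ hc
    (norm_rpow_freqNorm_le (d := d) (γ := γ))) x).trans
    (tsum_norm_le_of_symbol hσ hγ zero_le_one hc (norm_rpow_freqNorm_le (d := d) (γ := γ)))
  rw [← Real.norm_eq_abs, ← Complex.norm_real, evolutionRHS_eq_fourierSeries hT hC hp hf hσ hc,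
    add_assoc]
  refine (norm_add_le _ _).trans (add_le_add ?_ ((norm_add_le _ _).trans (add_le_add ?_ ?_)))
  · rw [norm_mul, norm_neg, norm_one, one_mul]
    refine (norm_sum_le_of_le _ fun j _ => (?_ : _ ≤
      (d * C₀ * (M * ∑' k : Fin d → ℤ, freqNorm k ^ (1 : ℝ) * Real.exp (-σ * freqNorm k))) *
      (1 * (M * ∑' k : Fin d → ℤ, freqNorm k ^ (1 : ℝ) * Real.exp (-σ * freqNorm k))))).trans_eq
      ?_
    · rw [norm_mul]
      exact mul_le_mul (b1 j) (b2 j) (norm_nonneg _) ((norm_nonneg _).trans (b1 j))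
    · simp only [Finset.sum_const, Finset.card_univ, Fintype.card_fin, nsmul_eq_mul]
  · rw [norm_mul, norm_neg, Complex.norm_real, Real.norm_of_nonneg hκ]
    exact mul_le_mul_of_nonneg_left b3 hκ
  · rw [Complex.norm_real, Real.norm_eq_abs]

end Fields

lemma norm_coeff_le_of_analyticNorm_le {σ : ℝ} {M : ℝ≥0} {f : (Fin d → ℝ) → ℝ}
    (h : analyticNorm 0 σ f ≤ M) (h0 : MeanZero f) (k : Fin d → ℤ) :
    ‖coeff f k‖ ≤ M * Real.exp (-σ * freqNorm k) := by
  by_cases hk : k = 0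
  · rw [hk, coeff_zero_of_meanZero h0, norm_zero]
    positivity
  · have h1 := ENNReal.le_tsum (f := fun k : {k : Fin d → ℤ // k ≠ 0} =>
      ENNReal.ofReal (freqNorm k.1 ^ (2 * (0 : ℝ)) * Real.exp (2 * σ * freqNorm k.1) *
        ‖coeff f k.1‖ ^ 2)) ⟨k, hk⟩
    have h2 := (ENNReal.rpow_le_rpow h1 (by norm_num : (0 : ℝ) ≤ 1 / 2)).trans h
    have e : freqNorm k ^ (2 * (0 : ℝ)) * Real.exp (2 * σ * freqNorm k) * ‖coeff f k‖ ^ 2 =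
        (Real.exp (σ * freqNorm k) * ‖coeff f k‖) ^ 2 := by
      rw [mul_zero, Real.rpow_zero, one_mul, mul_pow, ← Real.exp_nat_mul]
      congr 2
      push_cast
      ring
    rw [e, ENNReal.ofReal_rpow_of_nonneg (by positivity) (by norm_num), ← Real.sqrt_eq_rpow,
      Real.sqrt_sq (by positivity), ← ENNReal.ofReal_coe_nnreal] at h2
    replace h2 := (ENNReal.ofReal_le_ofReal_iff M.2).mp h2
    rw [neg_mul, Real.exp_neg, ← div_eq_mul_inv, le_div_iff₀ (Real.exp_pos _), mul_comm]
    exact h2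

section Solution

variable {T : Fin d → Fin d → (Fin d → ℤ) → ℂ} {γ κ Tbar τbar : ℝ} {θ₀ S : (Fin d → ℝ) → ℝ}
  {θ : ℝ → (Fin d → ℝ) → ℝ}

lemma IsAnalyticSolution.exists_decay (h : IsAnalyticSolution T γ κ θ₀ S Tbar τbar θ) {σ : ℝ}
    (hσ : 0 < σ) (hστ : σ < τbar) :
    ∃ M : ℝ, ∀ t ∈ Set.Icc 0 Tbar, ∀ k, ‖coeff (θ t) k‖ ≤ M * Real.exp (-σ * freqNorm k) := by
  obtain ⟨M, hM⟩ := h.radius σ hσ hστ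
  exact ⟨M, fun t ht k => norm_coeff_le_of_analyticNorm_le (hM t ht) (h.meanZero t ht) k⟩

lemma IsAnalyticSolution.exists_bound_evolutionRHS
    (h : IsAnalyticSolution T γ κ θ₀ S Tbar τbar θ) (hT : IsAdmissible T) (hγ : 0 ≤ γ)
    (hκ : 0 ≤ κ) (hS : Continuous S) (hτ : 0 < τbar) :
    ∃ K : ℝ, ∀ t ∈ Set.Icc 0 Tbar, ∀ x ∈ cube d, |evolutionRHS T γ κ S (θ t) x| ≤ K := by
  obtain ⟨C₀, hC₀, hC⟩ := hT.exists_bound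
  obtain ⟨M, hM⟩ := h.exists_decay (half_pos hτ) (half_lt_self hτ)
  obtain ⟨B, hB⟩ := isCompact_cube.exists_bound_of_continuousOn (f := S) hS.continuousOn
  exact ⟨_, fun t ht x hx => (abs_evolutionRHS_le hT hC₀.le hC hγ hκ (h.periodic t ht)
    (h.continuous t ht) (half_pos hτ) (hM t ht) x).trans (add_le_add_right (hB x hx) _)⟩

lemma IsAnalyticSolution.continuousOn_coeff
    (h : IsAnalyticSolution T γ κ θ₀ S Tbar τbar θ) (hT : IsAdmissible T) (hγ : 0 ≤ γ)
    (hκ : 0 ≤ κ) (hS : Continuous S) (hτ : 0 < τbar) (k : Fin d → ℤ) :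
    ContinuousOn (fun t => coeff (θ t) k) (Set.Icc 0 Tbar) := by
  obtain ⟨K, hK⟩ := h.exists_bound_evolutionRHS hT hγ hκ hS hτ
  have hlip : LipschitzOnWith K.toNNReal (fun t => coeff (θ t) k) (Set.Icc 0 Tbar) := by
    refine LipschitzOnWith.of_dist_le_mul fun s hs t ht => ?_
    rw [dist_eq_norm, ← coeff_sub (h.continuous s hs) (h.continuous t ht)]
    refine norm_coeff_le_of_bound (fun x hx => ?_) k
    have := (convex_Icc (0 : ℝ) Tbar).norm_image_sub_le_of_norm_hasDerivWithin_le
      (f := fun s => θ s x) (C := K) (fun u hu => h.equation u hu x)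
      (fun u hu => hK u hu x hx) ht hs
    refine this.trans ?_
    rw [dist_eq_norm]
    exact mul_le_mul_of_nonneg_right (Real.le_coe_toNNReal K) (norm_nonneg _)
  exact hlip.continuousOn

/-- The Fourier coefficients of a solution satisfy the expected system of ordinary differential
equations. -/
lemma IsAnalyticSolution.hasDerivAt_coeff
    (h : IsAnalyticSolution T γ κ θ₀ S Tbar τbar θ) (hT : IsAdmissible T) (hγ : 0 ≤ γ)
    (hκ : 0 ≤ κ) (hS : Continuous S) (hτ : 0 < τbar) {t : ℝ} (ht : t ∈ Set.Ioo 0 Tbar)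
    (k : Fin d → ℤ) :
    HasDerivAt (fun s => coeff (θ s) k)
      (-transport T (coeff (θ t)) (coeff (θ t)) k - κ * (freqNorm k ^ γ : ℝ) * coeff (θ t) k +
        coeff S k) t := by
  obtain ⟨C₀, hC₀, hC⟩ := hT.exists_bound
  obtain ⟨M, hM⟩ := h.exists_decay (half_pos hτ) (half_lt_self hτ)
  obtain ⟨K, hK⟩ := h.exists_bound_evolutionRHS hT hγ hκ hS hτ
  have htI := Set.Ioo_subset_Icc_self ht
  have hU : Set.Ioo 0 Tbar ∈ nhds t := isOpen_Ioo.mem_nhds ht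
  rw [← coeff_evolutionRHS hT hC hγ hS (h.periodic t htI) (h.continuous t htI) (half_pos hτ)
    (hM t htI)]
  have hcont : ∀ {g : (Fin d → ℝ) → ℝ}, Continuous g →
      Continuous fun x => (g x : ℂ) * character (-k) x := fun hg =>
    (Complex.continuous_ofReal.comp hg).mul (continuous_character _)
  refine HasDerivAt.const_mul _ ?_
  refine (hasDerivAt_integral_of_dominated_loc_of_deriv_le (μ := volume.restrict (cube d))
    (F := fun s x => (θ s x : ℂ) * character (-k) x)
    (F' := fun s x => (evolutionRHS T γ κ S (θ s) x : ℂ) * character (-k) x)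
    (bound := fun _ => K) hU ?_ ?_ ?_ ?_ ?_ ?_).2
  · filter_upwards [hU] with s hs
    exact (hcont (h.continuous s (Set.Ioo_subset_Icc_self hs))).aestronglyMeasurable
  · exact integrableOn_cube (hcont (h.continuous t htI))
  · exact (hcont (continuous_evolutionRHS hT hC hγ hS (h.periodic t htI) (h.continuous t htI)
      (half_pos hτ) (hM t htI))).aestronglyMeasurable
  · refine (ae_restrict_iff' isCompact_cube.measurableSet).mpr (ae_of_all _ fun x hx s hs => ?_)
    rw [norm_mul, norm_character, mul_one, Complex.norm_real]
    exact hK s (Set.Ioo_subset_Icc_self hs) x hx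
  · exact integrableOn_const isCompact_cube.measure_lt_top.ne
  · refine ae_of_all _ fun x s hs => ?_
    have h1 := (h.equation s (Set.Ioo_subset_Icc_self hs) x).hasDerivAt
      (Icc_mem_nhds hs.1 hs.2)
    exact (h1.ofReal_comp).mul_const _

end Solution

/-! ### Weighted Wiener norms -/

/-- The analytic Wiener norm `∑_k |k|^s e^{τ|k|} |c_k|` of a sequence of Fourier coefficients. -/
def wienerNorm (s τ : ℝ) (c : (Fin d → ℤ) → ℂ) : ℝ≥0∞ :=
  ∑' k, ENNReal.ofReal (freqNorm k ^ s * Real.exp (τ * freqNorm k)) * ‖c k‖ₑ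

lemma weight_nonneg (s τ : ℝ) (k : Fin d → ℤ) :
    0 ≤ freqNorm k ^ s * Real.exp (τ * freqNorm k) :=
  mul_nonneg (Real.rpow_nonneg (freqNorm_nonneg k) _) (Real.exp_pos _).le

lemma ofReal_mul_enorm {x : ℝ} (hx : 0 ≤ x) (z : ℂ) :
    ENNReal.ofReal x * ‖z‖ₑ = ENNReal.ofReal (x * ‖z‖) := by
  rw [ENNReal.ofReal_mul hx, ofReal_norm]

lemma summable_weight_of_decay {σ τ s M : ℝ} (hτ : τ < σ) (hs : 0 ≤ s) {c : (Fin d → ℤ) → ℂ}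
    (hc : ∀ k, ‖c k‖ ≤ M * Real.exp (-σ * freqNorm k)) :
    Summable fun k => freqNorm k ^ s * Real.exp (τ * freqNorm k) * ‖c k‖ := by
  refine Summable.of_nonneg_of_le (fun k => mul_nonneg (weight_nonneg s τ k) (norm_nonneg _))
    (fun k => ?_) ((summable_rpow_mul_exp_neg (d := d) hs (sub_pos.mpr hτ)).mul_left M)
  refine (mul_le_mul_of_nonneg_left (hc k) (weight_nonneg s τ k)).trans_eq ?_
  rw [show -(σ - τ) * freqNorm k = τ * freqNorm k + -σ * freqNorm k by ring, Real.exp_add]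
  ring

lemma wienerNorm_le_of_decay {σ τ s M : ℝ} (hτ : τ < σ) (hs : 0 ≤ s) {c : (Fin d → ℤ) → ℂ}
    (hc : ∀ k, ‖c k‖ ≤ M * Real.exp (-σ * freqNorm k)) :
    wienerNorm s τ c ≤ ENNReal.ofReal
      (∑' k : Fin d → ℤ, M * (freqNorm k ^ s * Real.exp (-(σ - τ) * freqNorm k))) := by
  have hM := nonneg_of_decay hc
  rw [ENNReal.ofReal_tsum_of_nonneg
    (fun k => mul_nonneg hM (weight_nonneg s (-(σ - τ)) k))
    ((summable_rpow_mul_exp_neg (d := d) hs (sub_pos.mpr hτ)).mul_left M)]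
  refine ENNReal.tsum_le_tsum fun k => ?_
  rw [ofReal_mul_enorm (weight_nonneg s τ k)]
  refine ENNReal.ofReal_le_ofReal ?_
  refine (mul_le_mul_of_nonneg_left (hc k) (weight_nonneg s τ k)).trans_eq ?_
  rw [show -(σ - τ) * freqNorm k = τ * freqNorm k + -σ * freqNorm k by ring, Real.exp_add]
  ring

lemma wienerNorm_eq_ofReal_tsum {σ τ s M : ℝ} (hτ : τ < σ) (hs : 0 ≤ s) {c : (Fin d → ℤ) → ℂ}
    (hc : ∀ k, ‖c k‖ ≤ M * Real.exp (-σ * freqNorm k)) :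
    wienerNorm s τ c = ENNReal.ofReal
      (∑' k, freqNorm k ^ s * Real.exp (τ * freqNorm k) * ‖c k‖) := by
  rw [ENNReal.ofReal_tsum_of_nonneg
    (fun k => mul_nonneg (weight_nonneg s τ k) (norm_nonneg _))
    (summable_weight_of_decay hτ hs hc)]
  exact tsum_congr fun k => ofReal_mul_enorm (weight_nonneg s τ k) _

lemma wienerNorm_mono {s s' τ τ' : ℝ} (hs : 0 < s) (hss : s ≤ s') (hτ : τ ≤ τ')
    (c : (Fin d → ℤ) → ℂ) : wienerNorm s τ c ≤ wienerNorm s' τ' c := by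
  refine ENNReal.tsum_le_tsum fun k => ?_
  gcongr ENNReal.ofReal ?_ * _
  by_cases hk : k = 0
  · rw [hk, freqNorm_zero, Real.zero_rpow hs.ne', Real.zero_rpow (by linarith)]
    simp
  · have h1 := one_le_freqNorm hk
    have h0 := freqNorm_nonneg k
    gcongr

/-- The nonnegative convolution majorising the quadratic term. -/
def derivConv (p q : (Fin d → ℤ) → ℂ) (k : Fin d → ℤ) : ℝ≥0∞ :=
  ∑' m, ENNReal.ofReal (freqNorm m * freqNorm (k - m)) * (‖p m‖ₑ * ‖q (k - m)‖ₑ)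

lemma tsum_tsum_mul_sub (f g : (Fin d → ℤ) → ℝ≥0∞) :
    ∑' k, ∑' m, f m * g (k - m) = (∑' m, f m) * ∑' n, g n := by
  rw [ENNReal.tsum_comm, ← ENNReal.tsum_mul_right]
  refine tsum_congr fun m => ?_
  rw [ENNReal.tsum_mul_left]
  congr 1
  exact (Equiv.subRight m).tsum_eq g

/-- Of the three derivatives falling on a product, the one in front is shared between the factors
by the triangle inequality, so that no factor carries more than two. -/
lemma tsum_weight_mul_derivConv_le {τ : ℝ} (hτ : 0 ≤ τ) (p q : (Fin d → ℤ) → ℂ) :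
    ∑' k, ENNReal.ofReal (freqNorm k ^ (1 : ℝ) * Real.exp (τ * freqNorm k)) * derivConv p q k ≤
      wienerNorm 2 τ p * wienerNorm 1 τ q + wienerNorm 1 τ p * wienerNorm 2 τ q := by
  unfold wienerNorm
  rw [← tsum_tsum_mul_sub, ← tsum_tsum_mul_sub, ← ENNReal.tsum_add]
  refine ENNReal.tsum_le_tsum fun k => ?_
  rw [derivConv, ← ENNReal.tsum_mul_left, ← ENNReal.tsum_add]
  refine ENNReal.tsum_le_tsum fun m => ?_
  set n := k - m with hn
  have hm0 := freqNorm_nonneg m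
  have hn0 := freqNorm_nonneg n
  have hk0 := freqNorm_nonneg k
  have hk := freqNorm_le_add_sub k m
  rw [← hn] at hk
  have hexp : Real.exp (τ * freqNorm k) ≤
      Real.exp (τ * freqNorm m) * Real.exp (τ * freqNorm n) := by
    rw [← Real.exp_add, ← mul_add]
    gcongr
  have key : freqNorm k ^ (1 : ℝ) * Real.exp (τ * freqNorm k) * (freqNorm m * freqNorm n) ≤
      freqNorm m ^ (2 : ℝ) * Real.exp (τ * freqNorm m) *
        (freqNorm n ^ (1 : ℝ) * Real.exp (τ * freqNorm n)) +
      freqNorm m ^ (1 : ℝ) * Real.exp (τ * freqNorm m) *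
        (freqNorm n ^ (2 : ℝ) * Real.exp (τ * freqNorm n)) := by
    simp only [Real.rpow_one, Real.rpow_two]
    calc freqNorm k * Real.exp (τ * freqNorm k) * (freqNorm m * freqNorm n)
        ≤ (freqNorm m + freqNorm n) * (Real.exp (τ * freqNorm m) * Real.exp (τ * freqNorm n)) *
          (freqNorm m * freqNorm n) := by gcongr
      _ = _ := by ring
  calc ENNReal.ofReal (freqNorm k ^ (1 : ℝ) * Real.exp (τ * freqNorm k)) *
        (ENNReal.ofReal (freqNorm m * freqNorm n) * (‖p m‖ₑ * ‖q n‖ₑ))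
      = ENNReal.ofReal (freqNorm k ^ (1 : ℝ) * Real.exp (τ * freqNorm k) *
          (freqNorm m * freqNorm n)) * (‖p m‖ₑ * ‖q n‖ₑ) := by
        rw [ENNReal.ofReal_mul (weight_nonneg 1 τ k), mul_assoc]
    _ ≤ ENNReal.ofReal (freqNorm m ^ (2 : ℝ) * Real.exp (τ * freqNorm m) *
        (freqNorm n ^ (1 : ℝ) * Real.exp (τ * freqNorm n)) +
      freqNorm m ^ (1 : ℝ) * Real.exp (τ * freqNorm m) *
        (freqNorm n ^ (2 : ℝ) * Real.exp (τ * freqNorm n))) * (‖p m‖ₑ * ‖q n‖ₑ) := by gcongr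
    _ = _ := by
        rw [ENNReal.ofReal_add (mul_nonneg (weight_nonneg _ _ _) (weight_nonneg _ _ _))
          (mul_nonneg (weight_nonneg _ _ _) (weight_nonneg _ _ _)),
          ENNReal.ofReal_mul (weight_nonneg 2 τ m), ENNReal.ofReal_mul (weight_nonneg 1 τ m)]
        ring

/-! ### The difference of two solutions -/

/-- Forcing in the equation `∂_t φ + κ Λ^γ φ = F` for the difference `φ = a - b` of a viscous
solution `a` and an inviscid solution `b`, in Fourier variables. -/
def differenceForcing (T : Fin d → Fin d → (Fin d → ℤ) → ℂ) (γ κ : ℝ) (a b : (Fin d → ℤ) → ℂ)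
    (k : Fin d → ℤ) : ℂ :=
  -(transport T a a k - transport T b b k) - κ * (freqNorm k ^ γ : ℝ) * b k

section Transport

variable {T : Fin d → Fin d → (Fin d → ℤ) → ℂ} {C σ : ℝ}

lemma summable_transport_bound (hσ : 0 < σ) (M : ℝ) (k : Fin d → ℤ) :
    Summable fun m : Fin d → ℤ => C * (freqNorm m * freqNorm (k - m)) *
      ((M * Real.exp (-σ * freqNorm m)) * (M * Real.exp (-σ * freqNorm (k - m)))) := by
  have hs : Summable fun m : Fin d → ℤ => freqNorm m * Real.exp (-σ * freqNorm m) := by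
    simpa using summable_rpow_mul_exp_neg (d := d) zero_le_one hσ
  have hnn : ∀ m : Fin d → ℤ, 0 ≤ freqNorm m * Real.exp (-σ * freqNorm m) := fun m =>
    mul_nonneg (freqNorm_nonneg m) (Real.exp_pos _).le
  have h1 : Summable fun m : Fin d → ℤ => (freqNorm m * Real.exp (-σ * freqNorm m)) *
      (freqNorm (k - m) * Real.exp (-σ * freqNorm (k - m))) :=
    Summable.of_nonneg_of_le (fun m => mul_nonneg (hnn m) (hnn _))
      (fun m => mul_le_mul_of_nonneg_left (hs.le_tsum (k - m) fun _ _ => hnn _) (hnn m))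
      (hs.mul_right _)
  refine (h1.mul_left (C * M * M)).congr fun m => ?_
  ring

lemma norm_transport_term_le (hC0 : 0 ≤ C)
    (hC : ∀ m n, ‖interaction T m n‖ ≤ C * (freqNorm m * freqNorm n)) {M : ℝ}
    {a : (Fin d → ℤ) → ℂ} (ha : ∀ k, ‖a k‖ ≤ M * Real.exp (-σ * freqNorm k))
    (k m : Fin d → ℤ) :
    ‖interaction T m (k - m) * (a m * a (k - m))‖ ≤ C * (freqNorm m * freqNorm (k - m)) *
      ((M * Real.exp (-σ * freqNorm m)) * (M * Real.exp (-σ * freqNorm (k - m)))) := by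
  have hM := nonneg_of_decay ha
  rw [norm_mul, norm_mul]
  exact mul_le_mul (hC m _) (mul_le_mul (ha m) (ha _) (norm_nonneg _) (by positivity))
    (by positivity)
    (mul_nonneg hC0 (mul_nonneg (freqNorm_nonneg _) (freqNorm_nonneg _)))

lemma continuousOn_transport (hσ : 0 < σ) (hC0 : 0 ≤ C)
    (hC : ∀ m n, ‖interaction T m n‖ ≤ C * (freqNorm m * freqNorm n)) {M : ℝ} {I : Set ℝ}
    {a : ℝ → (Fin d → ℤ) → ℂ} (hcont : ∀ k, ContinuousOn (fun t => a t k) I)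
    (ha : ∀ t ∈ I, ∀ k, ‖a t k‖ ≤ M * Real.exp (-σ * freqNorm k)) (k : Fin d → ℤ) :
    ContinuousOn (fun t => transport T (a t) (a t) k) I :=
  continuousOn_tsum (fun m => continuousOn_const.mul ((hcont m).mul (hcont (k - m))))
    (summable_transport_bound hσ M k) fun m t ht => norm_transport_term_le hC0 hC (ha t ht) k m

lemma enorm_differenceForcing_le {γ κ : ℝ} (hκ : 0 ≤ κ) (hσ : 0 < σ) (hC0 : 0 ≤ C)
    (hC : ∀ m n, ‖interaction T m n‖ ≤ C * (freqNorm m * freqNorm n)) {Ma Mb : ℝ}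
    {a b : (Fin d → ℤ) → ℂ} (ha : ∀ k, ‖a k‖ ≤ Ma * Real.exp (-σ * freqNorm k))
    (hb : ∀ k, ‖b k‖ ≤ Mb * Real.exp (-σ * freqNorm k)) (k : Fin d → ℤ) :
    ‖differenceForcing T γ κ a b k‖ₑ ≤
      ENNReal.ofReal C * (derivConv (a - b) (a - b) k + derivConv (a - b) b k +
        derivConv b (a - b) k) +
      ENNReal.ofReal κ * (ENNReal.ofReal (freqNorm k ^ γ) * ‖b k‖ₑ) := by
  have sa : Summable fun m => interaction T m (k - m) * (a m * a (k - m)) :=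
    Summable.of_norm_bounded (summable_transport_bound hσ Ma k)
      fun m => norm_transport_term_le hC0 hC ha k m
  have sb : Summable fun m => interaction T m (k - m) * (b m * b (k - m)) :=
    Summable.of_norm_bounded (summable_transport_bound hσ Mb k)
      fun m => norm_transport_term_le hC0 hC hb k m
  unfold differenceForcing
  refine (enorm_sub_le).trans (add_le_add ?_ ?_)
  · rw [enorm_neg, transport, transport, ← sa.tsum_sub sb]
    refine (enorm_tsum_le_tsum_enorm).trans ?_
    simp only [derivConv]
    rw [← ENNReal.tsum_add, ← ENNReal.tsum_add, ← ENNReal.tsum_mul_left]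
    refine ENNReal.tsum_le_tsum fun m => ?_
    set n := k - m
    have e : interaction T m n * (a m * a n) - interaction T m n * (b m * b n) =
        interaction T m n * ((a - b) m * (a - b) n + (a - b) m * b n + b m * (a - b) n) := by
      simp only [Pi.sub_apply]
      ring
    have hi : ‖interaction T m n‖ₑ ≤
        ENNReal.ofReal C * ENNReal.ofReal (freqNorm m * freqNorm n) := by
      rw [← ENNReal.ofReal_mul hC0, ← ofReal_norm]
      exact ENNReal.ofReal_le_ofReal (hC m n)
    rw [e, enorm_mul]
    refine (mul_le_mul' hi ((enorm_add_le _ _).trans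
      (add_le_add_left (enorm_add_le _ _) _))).trans_eq ?_
    simp only [enorm_mul]
    ring
  · rw [enorm_mul, enorm_mul, ← ofReal_norm (κ : ℂ), ← ofReal_norm ((freqNorm k ^ γ : ℝ) : ℂ),
      Complex.norm_real, Complex.norm_real, Real.norm_of_nonneg hκ,
      Real.norm_of_nonneg (Real.rpow_nonneg (freqNorm_nonneg k) _), mul_assoc]

/-- Wiener-norm bound of the forcing: it is linear in the top-order norm of the difference. -/
lemma tsum_weight_differenceForcing_le {γ κ τ : ℝ} (hκ : 0 ≤ κ) (hγ : 0 < γ) (hτ : 0 ≤ τ)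
    (hσ : 0 < σ) (hC0 : 0 ≤ C)
    (hC : ∀ m n, ‖interaction T m n‖ ≤ C * (freqNorm m * freqNorm n)) {Ma Mb : ℝ}
    {a b : (Fin d → ℤ) → ℂ} (ha : ∀ k, ‖a k‖ ≤ Ma * Real.exp (-σ * freqNorm k))
    (hb : ∀ k, ‖b k‖ ≤ Mb * Real.exp (-σ * freqNorm k)) :
    ∑' k, ENNReal.ofReal (freqNorm k ^ (1 : ℝ) * Real.exp (τ * freqNorm k)) *
        ‖differenceForcing T γ κ a b k‖ₑ ≤
      ENNReal.ofReal C * (2 * wienerNorm 1 τ (a - b) + 4 * wienerNorm 2 τ b) *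
        wienerNorm 2 τ (a - b) + ENNReal.ofReal κ * wienerNorm (1 + γ) τ b := by
  set w : (Fin d → ℤ) → ℝ≥0∞ := fun k =>
    ENNReal.ofReal (freqNorm k ^ (1 : ℝ) * Real.exp (τ * freqNorm k)) with hw
  have e1 : ∀ k, w k * (ENNReal.ofReal (freqNorm k ^ γ) * ‖b k‖ₑ) =
      ENNReal.ofReal (freqNorm k ^ (1 + γ) * Real.exp (τ * freqNorm k)) * ‖b k‖ₑ := fun k => by
    rw [hw, ← mul_assoc, ← ENNReal.ofReal_mul (weight_nonneg 1 τ k),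
      Real.rpow_add_of_nonneg (freqNorm_nonneg k) zero_le_one hγ.le]
    congr 2
    ring
  have hφ := wienerNorm_mono one_pos one_le_two (le_refl τ) (a - b)
  have hbb := wienerNorm_mono one_pos one_le_two (le_refl τ) b
  calc ∑' k, w k * ‖differenceForcing T γ κ a b k‖ₑ
      ≤ ∑' k, (ENNReal.ofReal C * (w k * derivConv (a - b) (a - b) k +
          w k * derivConv (a - b) b k + w k * derivConv b (a - b) k) +
          ENNReal.ofReal κ * (w k * (ENNReal.ofReal (freqNorm k ^ γ) * ‖b k‖ₑ))) := by
        refine ENNReal.tsum_le_tsum fun k => ?_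
        refine (mul_le_mul_right
          (enorm_differenceForcing_le (γ := γ) hκ hσ hC0 hC ha hb k) _).trans_eq ?_
        ring
    _ = ENNReal.ofReal C * (∑' k, w k * derivConv (a - b) (a - b) k +
          ∑' k, w k * derivConv (a - b) b k + ∑' k, w k * derivConv b (a - b) k) +
          ENNReal.ofReal κ * wienerNorm (1 + γ) τ b := by
        rw [ENNReal.tsum_add, ENNReal.tsum_mul_left, ENNReal.tsum_mul_left, ENNReal.tsum_add,
          ENNReal.tsum_add]
        simp_rw [e1]
        rfl
    _ ≤ ENNReal.ofReal C * ((wienerNorm 2 τ (a - b) * wienerNorm 1 τ (a - b) +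
            wienerNorm 1 τ (a - b) * wienerNorm 2 τ (a - b)) +
          (wienerNorm 2 τ (a - b) * wienerNorm 2 τ b +
            wienerNorm 2 τ (a - b) * wienerNorm 2 τ b) +
          (wienerNorm 2 τ b * wienerNorm 2 τ (a - b) +
            wienerNorm 2 τ b * wienerNorm 2 τ (a - b))) +
          ENNReal.ofReal κ * wienerNorm (1 + γ) τ b := by
        gcongr
        · exact tsum_weight_mul_derivConv_le hτ _ _
        · exact (tsum_weight_mul_derivConv_le hτ _ _).trans (by gcongr)
        · exact (tsum_weight_mul_derivConv_le hτ _ _).trans (by gcongr)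
    _ = _ := by ring

end Transport

/-! ### Dissipation and a shrinking weight -/

/-- Dissipation does not increase the modulus. -/
lemma norm_le_integral_of_hasDerivAt {b F : ℝ → ℂ} {μ t : ℝ} (hμ : 0 ≤ μ) (ht : 0 ≤ t)
    (hF : Continuous F) (hb : ContinuousOn b (Set.Icc 0 t))
    (hd : ∀ s ∈ Set.Ioo 0 t, HasDerivAt b (F s - μ * b s) s) (h0 : b 0 = 0) :
    ‖b t‖ ≤ ∫ s in 0..t, ‖F s‖ := by
  have hE : ∀ s : ℝ, HasDerivAt (fun s : ℝ => Complex.exp (μ * s))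
      (Complex.exp (μ * s) * μ) s := fun s => by
    have h1 : HasDerivAt (fun s : ℝ => (μ : ℂ) * (s : ℂ)) ((μ : ℂ) * 1) s :=
      (Complex.ofRealCLM.hasDerivAt (x := s)).const_mul (μ : ℂ)
    simpa using h1.cexp
  have hEn : ∀ s : ℝ, ‖Complex.exp (μ * s)‖ = Real.exp (μ * s) := fun s => by
    rw [Complex.norm_exp]
    simp
  have hint := intervalIntegral.integral_eq_sub_of_hasDerivAt_of_le ht
    (f := fun s => Complex.exp (μ * s) * b s) (f' := fun s => Complex.exp (μ * s) * F s)
    ((by fun_prop : Continuous fun s : ℝ => Complex.exp (μ * s)).continuousOn.mul hb)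
    (fun s hs => ((hE s).mul (hd s hs)).congr_deriv (by ring))
    ((by fun_prop : Continuous fun s : ℝ => Complex.exp (μ * s) * F s).intervalIntegrable _ _)
  rw [h0, mul_zero, sub_zero] at hint
  have h1 : ‖Complex.exp (μ * t) * b t‖ ≤ ∫ s in 0..t, Real.exp (μ * t) * ‖F s‖ := by
    rw [← hint]
    refine (intervalIntegral.norm_integral_le_integral_norm ht).trans
      (intervalIntegral.integral_mono_on ht ?_ ?_ fun s hs => ?_)
    · exact (by fun_prop : Continuous fun s : ℝ => ‖Complex.exp (μ * s) * F s‖).intervalIntegrable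
        _ _
    · exact (by fun_prop : Continuous fun s : ℝ => Real.exp (μ * t) * ‖F s‖).intervalIntegrable _ _
    · rw [norm_mul, hEn]
      gcongr
      exact hs.2
  rw [norm_mul, hEn, intervalIntegral.integral_const_mul] at h1
  exact le_of_mul_le_mul_left h1 (Real.exp_pos _)

/-- A weight decaying at rate `ν` yields, besides the weighted modulus at the final time, control
of its time integral with a factor `ν`. -/
lemma exp_mul_norm_add_integral_le {b F : ℝ → ℂ} {μ ν t : ℝ} (hμ : 0 ≤ μ) (hν : 0 ≤ ν)
    (ht : 0 ≤ t) (hF : Continuous F) (hb : ContinuousOn b (Set.Icc 0 t))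
    (hd : ∀ s ∈ Set.Ioo 0 t, HasDerivAt b (F s - μ * b s) s) (h0 : b 0 = 0) :
    Real.exp (-ν * t) * ‖b t‖ + ∫ s in 0..t, ν * (Real.exp (-ν * s) * ‖b s‖) ≤
      ∫ s in 0..t, Real.exp (-ν * s) * ‖F s‖ := by
  -- The primitive `h` of `‖F‖` dominates `‖b‖`, and the claim for `h` is an equality.
  set h : ℝ → ℝ := fun s => ∫ r in 0..s, ‖F r‖ with hh
  have hbh : ∀ s ∈ Set.Icc 0 t, ‖b s‖ ≤ h s := fun s hs =>
    norm_le_integral_of_hasDerivAt hμ hs.1 hF (hb.mono (Set.Icc_subset_Icc_right hs.2))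
      (fun r hr => hd r ⟨hr.1, hr.2.trans_le hs.2⟩) h0
  have hhd : ∀ s, HasDerivAt h ‖F s‖ s := fun s =>
    (hF.norm.integral_hasStrictDerivAt 0 s).hasDerivAt
  have hhc : Continuous h := continuous_iff_continuousAt.mpr fun s => (hhd s).continuousAt
  have hexp : ∀ s : ℝ, HasDerivAt (fun s => Real.exp (-ν * s)) (Real.exp (-ν * s) * (-ν)) s :=
    fun s => by simpa using ((hasDerivAt_id s).const_mul (-ν)).exp
  have i1 : IntervalIntegrable (fun s => Real.exp (-ν * s) * ‖F s‖) volume 0 t :=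
    (by fun_prop : Continuous fun s : ℝ => Real.exp (-ν * s) * ‖F s‖).intervalIntegrable _ _
  have i2 : IntervalIntegrable (fun s => ν * (Real.exp (-ν * s) * h s)) volume 0 t :=
    (by fun_prop : Continuous fun s : ℝ => ν * (Real.exp (-ν * s) * h s)).intervalIntegrable _ _
  have i3 : IntervalIntegrable (fun s => ν * (Real.exp (-ν * s) * ‖b s‖)) volume 0 t := by
    refine ContinuousOn.intervalIntegrable_of_Icc ht ?_
    exact continuousOn_const.mul
      ((by fun_prop : Continuous fun s : ℝ => Real.exp (-ν * s)).continuousOn.mul hb.norm)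
  have hint := intervalIntegral.integral_eq_sub_of_hasDerivAt (a := 0) (b := t)
    (f := fun s => Real.exp (-ν * s) * h s)
    (f' := fun s => Real.exp (-ν * s) * ‖F s‖ - ν * (Real.exp (-ν * s) * h s))
    (fun s _ => ((hexp s).mul (hhd s)).congr_deriv (by ring)) (i1.sub i2)
  rw [intervalIntegral.integral_sub i1 i2] at hint
  have h00 : h 0 = 0 := by simp [hh]
  rw [h00, mul_zero, sub_zero] at hint
  have m1 : ∫ s in 0..t, ν * (Real.exp (-ν * s) * ‖b s‖) ≤
      ∫ s in 0..t, ν * (Real.exp (-ν * s) * h s) := by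
    refine intervalIntegral.integral_mono_on ht i3 i2 fun s hs => ?_
    gcongr
    exact hbh s hs
  have m2 : Real.exp (-ν * t) * ‖b t‖ ≤ Real.exp (-ν * t) * h t := by
    gcongr
    exact hbh t ⟨ht, le_rfl⟩
  linarith

lemma ofReal_intervalIntegral_mul_norm {g : ℝ → ℝ} {b : ℝ → ℂ} {t : ℝ} (ht : 0 ≤ t)
    (hg : Continuous g) (hg0 : ∀ s, 0 ≤ g s) (hb : ContinuousOn b (Set.Icc 0 t)) :
    ENNReal.ofReal (∫ s in 0..t, g s * ‖b s‖) =
      ∫⁻ s in Set.Ioo 0 t, ENNReal.ofReal (g s) * ‖b s‖ₑ := by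
  rw [intervalIntegral.integral_of_le ht, integral_Ioc_eq_integral_Ioo,
    ofReal_integral_eq_lintegral_ofReal]
  · exact lintegral_congr fun s => (ofReal_mul_enorm (hg0 s) _).symm
  · exact ((hg.continuousOn.mul hb.norm).integrableOn_Icc).mono_set Set.Ioo_subset_Icc_self
  · exact Filter.Eventually.of_forall fun s => mul_nonneg (hg0 s) (norm_nonneg _)

/-- The weighted estimate at a single frequency of modulus `x`, with weight
`x e^{(τ₀ - λ t) x}`. -/
lemma weighted_mode_estimate {b F : ℝ → ℂ} {μ lam τ₀ x t : ℝ} (hμ : 0 ≤ μ) (hlam : 0 ≤ lam)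
    (hx : 0 ≤ x) (ht : 0 ≤ t) (hF : ContinuousOn F (Set.Icc 0 t))
    (hb : ContinuousOn b (Set.Icc 0 t))
    (hd : ∀ s ∈ Set.Ioo 0 t, HasDerivAt b (F s - μ * b s) s) (h0 : b 0 = 0) :
    ENNReal.ofReal (x ^ (1 : ℝ) * Real.exp ((τ₀ - lam * t) * x)) * ‖b t‖ₑ +
      ENNReal.ofReal lam * ∫⁻ s in Set.Ioo 0 t,
        ENNReal.ofReal (x ^ (2 : ℝ) * Real.exp ((τ₀ - lam * s) * x)) * ‖b s‖ₑ ≤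
    ∫⁻ s in Set.Ioo 0 t,
        ENNReal.ofReal (x ^ (1 : ℝ) * Real.exp ((τ₀ - lam * s) * x)) * ‖F s‖ₑ := by
  set G : ℝ → ℂ := Set.IccExtend ht ((Set.Icc 0 t).domRestrict F) with hG
  have hGc : Continuous G := Continuous.Icc_extend' (continuousOn_iff_continuous_domRestrict.mp hF)
  have hGF : ∀ s ∈ Set.Icc 0 t, G s = F s := fun s hs => Set.IccExtend_of_mem ht _ hs
  have key := exp_mul_norm_add_integral_le (ν := lam * x) hμ (mul_nonneg hlam hx) ht hGc hb
    (fun s hs => by rw [hGF s (Set.Ioo_subset_Icc_self hs)]; exact hd s hs) h0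
  have hw : ∀ s, x * Real.exp (τ₀ * x) * Real.exp (-(lam * x) * s) =
      x * Real.exp ((τ₀ - lam * s) * x) := fun s => by
    rw [mul_assoc, ← Real.exp_add]
    ring_nf
  have key2 := mul_le_mul_of_nonneg_left key (mul_nonneg hx (Real.exp_pos (τ₀ * x)).le)
  rw [mul_add, ← intervalIntegral.integral_const_mul, ← intervalIntegral.integral_const_mul,
    ← mul_assoc, hw] at key2
  have e1 : ∀ s, x * Real.exp (τ₀ * x) * (lam * x * (Real.exp (-(lam * x) * s) * ‖b s‖)) =
      lam * (x ^ (2 : ℝ) * Real.exp ((τ₀ - lam * s) * x) * ‖b s‖) := fun s => by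
    rw [Real.rpow_two]
    linear_combination lam * x * ‖b s‖ * hw s
  have e2 : ∀ s, x * Real.exp (τ₀ * x) * (Real.exp (-(lam * x) * s) * ‖G s‖) =
      x ^ (1 : ℝ) * Real.exp ((τ₀ - lam * s) * x) * ‖G s‖ := fun s => by
    rw [Real.rpow_one, ← mul_assoc, hw]
  simp_rw [e1, e2] at key2
  rw [intervalIntegral.integral_const_mul] at key2
  have key3 := ENNReal.ofReal_le_ofReal key2
  have hw0 : ∀ p s : ℝ, 0 ≤ x ^ p * Real.exp ((τ₀ - lam * s) * x) := fun p s =>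
    mul_nonneg (Real.rpow_nonneg hx _) (Real.exp_pos _).le
  rw [ENNReal.ofReal_add (mul_nonneg (mul_nonneg hx (Real.exp_pos _).le) (norm_nonneg _))
      (mul_nonneg hlam (intervalIntegral.integral_nonneg ht fun s _ =>
        mul_nonneg (hw0 2 s) (norm_nonneg _))),
    ENNReal.ofReal_mul hlam, ofReal_intervalIntegral_mul_norm ht (by fun_prop) (hw0 2) hb,
    ofReal_intervalIntegral_mul_norm ht (by fun_prop) (hw0 1) hGc.continuousOn] at key3
  have e3 : ∫⁻ s in Set.Ioo 0 t,
        ENNReal.ofReal (x ^ (1 : ℝ) * Real.exp ((τ₀ - lam * s) * x)) * ‖G s‖ₑ =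
      ∫⁻ s in Set.Ioo 0 t,
        ENNReal.ofReal (x ^ (1 : ℝ) * Real.exp ((τ₀ - lam * s) * x)) * ‖F s‖ₑ :=
    setLIntegral_congr_fun measurableSet_Ioo fun s hs => by
      simp only [hGF s (Set.Ioo_subset_Icc_self hs)]
  rw [e3] at key3
  rw [Real.rpow_one, ofReal_mul_enorm (mul_nonneg hx (Real.exp_pos _).le)]
  simpa only [Real.rpow_one] using key3

/-! ### Stability estimate -/

section Stability

variable {T : Fin d → Fin d → (Fin d → ℤ) → ℂ} {γ κ C σ τ₀ lam Ma Mb A B t₁ : ℝ}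
  {a b : ℝ → (Fin d → ℤ) → ℂ} {g : (Fin d → ℤ) → ℂ}

lemma norm_sub_le_of_decay {a b : (Fin d → ℤ) → ℂ}
    (ha : ∀ k, ‖a k‖ ≤ Ma * Real.exp (-σ * freqNorm k))
    (hb : ∀ k, ‖b k‖ ≤ Mb * Real.exp (-σ * freqNorm k)) (k : Fin d → ℤ) :
    ‖(a - b) k‖ ≤ (Ma + Mb) * Real.exp (-σ * freqNorm k) := by
  rw [add_mul]
  exact (norm_sub_le _ _).trans (add_le_add (ha k) (hb k))

/-- Summed over all frequencies: as long as the Wiener norm of the difference is at most `1`, the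
gain `λ ∫ wienerNorm 2` from the shrinking radius absorbs the transport terms, and the difference
is controlled by the viscous term of the inviscid solution alone. -/
lemma wienerNorm_sub_le_of_le_one (hκ : 0 ≤ κ) (hγ : 0 < γ) (hσ : 0 < σ) (hτσ : τ₀ < σ)
    (hC0 : 0 ≤ C) (hC : ∀ m n, ‖interaction T m n‖ ≤ C * (freqNorm m * freqNorm n))
    (hB : 0 ≤ B) (hA : 0 ≤ A) (hlam : lam = C * (2 + 4 * B)) (hτ₀ : lam * t₁ ≤ τ₀)
    (hac : ∀ k, ContinuousOn (fun t => a t k) (Set.Icc 0 t₁))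
    (hbc : ∀ k, ContinuousOn (fun t => b t k) (Set.Icc 0 t₁))
    (ha : ∀ t ∈ Set.Icc 0 t₁, ∀ k, ‖a t k‖ ≤ Ma * Real.exp (-σ * freqNorm k))
    (hb : ∀ t ∈ Set.Icc 0 t₁, ∀ k, ‖b t k‖ ≤ Mb * Real.exp (-σ * freqNorm k))
    (had : ∀ t ∈ Set.Ioo 0 t₁, ∀ k, HasDerivAt (fun s => a s k)
      (-transport T (a t) (a t) k - κ * (freqNorm k ^ γ : ℝ) * a t k + g k) t)
    (hbd : ∀ t ∈ Set.Ioo 0 t₁, ∀ k, HasDerivAt (fun s => b s k)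
      (-transport T (b t) (b t) k + g k) t)
    (hab : a 0 = b 0)
    (hbB : ∀ t ∈ Set.Icc 0 t₁, wienerNorm 2 τ₀ (b t) ≤ ENNReal.ofReal B)
    (hbA : ∀ t ∈ Set.Icc 0 t₁, wienerNorm (1 + γ) τ₀ (b t) ≤ ENNReal.ofReal A)
    {t : ℝ} (ht : t ∈ Set.Icc 0 t₁)
    (hsmall : ∀ s ∈ Set.Ioo 0 t, wienerNorm 1 (τ₀ - lam * s) (a s - b s) ≤ 1) :
    wienerNorm 1 (τ₀ - lam * t) (a t - b t) ≤ ENNReal.ofReal (κ * A * t) := by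
  have hlam0 : 0 ≤ lam := by rw [hlam]; positivity
  have hsub : Set.Icc 0 t ⊆ Set.Icc 0 t₁ := Set.Icc_subset_Icc_right ht.2
  have hioo : Set.Ioo 0 t ⊆ Set.Icc 0 t₁ := Set.Ioo_subset_Icc_self.trans hsub
  have hτs : ∀ s ∈ Set.Icc 0 t₁, 0 ≤ τ₀ - lam * s ∧ τ₀ - lam * s ≤ τ₀ := fun s hs => by
    have h1 := mul_le_mul_of_nonneg_left hs.2 hlam0
    have h2 := mul_nonneg hlam0 hs.1
    constructor <;> linarith
  have hμ : ∀ k : Fin d → ℤ, 0 ≤ κ * freqNorm k ^ γ := fun k =>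
    mul_nonneg hκ (Real.rpow_nonneg (freqNorm_nonneg k) _)
  have hφc : ∀ k, ContinuousOn (fun s => (a s - b s) k) (Set.Icc 0 t) := fun k =>
    ((hac k).sub (hbc k)).mono hsub
  have hFc : ∀ k, ContinuousOn (fun s => differenceForcing T γ κ (a s) (b s) k) (Set.Icc 0 t) :=
    fun k => ((((continuousOn_transport hσ hC0 hC hac ha k).sub
      (continuousOn_transport hσ hC0 hC hbc hb k)).neg).sub
        (continuousOn_const.mul (hbc k))).mono hsub
  have hmode := fun k : Fin d → ℤ => weighted_mode_estimate (τ₀ := τ₀) (hμ k) hlam0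
    (freqNorm_nonneg k) ht.1 (hFc k) (hφc k)
    (fun s hs => ((had s ⟨hs.1, hs.2.trans_le ht.2⟩ k).sub
      (hbd s ⟨hs.1, hs.2.trans_le ht.2⟩ k)).congr_deriv (by
        simp only [differenceForcing, Pi.sub_apply]
        push_cast
        ring)) (by simp [hab])
  have hmeas : ∀ (p : ℝ) (k : Fin d → ℤ) {f : ℝ → ℂ}, ContinuousOn f (Set.Icc 0 t) →
      AEMeasurable (fun s => ENNReal.ofReal (freqNorm k ^ p *
        Real.exp ((τ₀ - lam * s) * freqNorm k)) * ‖f s‖ₑ) (volume.restrict (Set.Ioo 0 t)) := by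
    intro p k f hf
    have h1 : Continuous fun s : ℝ => ENNReal.ofReal (freqNorm k ^ p *
        Real.exp ((τ₀ - lam * s) * freqNorm k)) := ENNReal.continuous_ofReal.comp (by fun_prop)
    exact h1.aemeasurable.mul
      ((hf.mono Set.Ioo_subset_Icc_self).aemeasurable measurableSet_Ioo).enorm
  have hsum := ENNReal.tsum_le_tsum hmode
  rw [ENNReal.tsum_add, ENNReal.tsum_mul_left, ← lintegral_tsum fun k => hmeas 2 k (hφc k),
    ← lintegral_tsum fun k => hmeas 1 k (hFc k)] at hsum
  change wienerNorm 1 (τ₀ - lam * t) (a t - b t) + ENNReal.ofReal lam *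
    ∫⁻ s in Set.Ioo 0 t, wienerNorm 2 (τ₀ - lam * s) (a s - b s) ≤ _ at hsum
  set I := ∫⁻ s in Set.Ioo 0 t, wienerNorm 2 (τ₀ - lam * s) (a s - b s) with hI
  have hIfin : ENNReal.ofReal lam * I ≠ ⊤ := by
    refine ENNReal.mul_ne_top ENNReal.ofReal_ne_top (ne_top_of_le_ne_top ?_
      (setLIntegral_mono' measurableSet_Ioo fun s hs =>
        (wienerNorm_mono two_pos le_rfl (hτs s (hioo hs)).2 _).trans
          (wienerNorm_le_of_decay hτσ zero_le_two
            (norm_sub_le_of_decay (ha s (hioo hs)) (hb s (hioo hs))))))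
    rw [setLIntegral_const]
    exact ENNReal.mul_ne_top ENNReal.ofReal_ne_top (by simp)
  have hrhs : ∫⁻ s in Set.Ioo 0 t, ∑' k, ENNReal.ofReal (freqNorm k ^ (1 : ℝ) *
      Real.exp ((τ₀ - lam * s) * freqNorm k)) * ‖differenceForcing T γ κ (a s) (b s) k‖ₑ ≤
      ENNReal.ofReal lam * I + ENNReal.ofReal (κ * A * t) := by
    calc _ ≤ ∫⁻ s in Set.Ioo 0 t, (ENNReal.ofReal lam *
            wienerNorm 2 (τ₀ - lam * s) (a s - b s) + ENNReal.ofReal (κ * A)) := by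
          refine setLIntegral_mono' measurableSet_Ioo fun s hs => ?_
          obtain ⟨h1, h2⟩ := hτs s (hioo hs)
          refine (tsum_weight_differenceForcing_le hκ hγ h1 hσ hC0 hC (ha s (hioo hs))
            (hb s (hioo hs))).trans (add_le_add (mul_le_mul_left ?_ _) ?_)
          · rw [hlam, ENNReal.ofReal_mul hC0, ENNReal.ofReal_add zero_le_two (by positivity),
              ENNReal.ofReal_mul (by norm_num : (0 : ℝ) ≤ 4), ENNReal.ofReal_ofNat,
              ENNReal.ofReal_ofNat]
            gcongr
            · exact (mul_le_mul_right (hlam ▸ hsmall s hs) 2).trans_eq (mul_one _)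
            · exact (wienerNorm_mono two_pos le_rfl (hlam ▸ h2) _).trans (hbB s (hioo hs))
          · rw [ENNReal.ofReal_mul hκ]
            gcongr
            exact (wienerNorm_mono (by linarith) le_rfl h2 _).trans (hbA s (hioo hs))
      _ = _ := by
          rw [lintegral_add_right _ measurable_const,
            lintegral_const_mul' _ _ ENNReal.ofReal_ne_top,
            setLIntegral_const, Real.volume_Ioo, sub_zero,
            ENNReal.ofReal_mul (mul_nonneg hκ hA)]
  have hfinal := hsum.trans hrhs
  rw [add_comm] at hfinal
  exact (ENNReal.add_le_add_iff_left hIfin).mp hfinal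

/-- Continuity in time removes the smallness assumption of `wienerNorm_sub_le_of_le_one`. -/
lemma wienerNorm_sub_le (hκ : 0 ≤ κ) (hγ : 0 < γ) (hσ : 0 < σ) (hτσ : τ₀ < σ)
    (hC0 : 0 ≤ C) (hC : ∀ m n, ‖interaction T m n‖ ≤ C * (freqNorm m * freqNorm n))
    (hB : 0 ≤ B) (hA : 0 ≤ A) (hlam : lam = C * (2 + 4 * B)) (hτ₀ : lam * t₁ ≤ τ₀)
    (hac : ∀ k, ContinuousOn (fun t => a t k) (Set.Icc 0 t₁))
    (hbc : ∀ k, ContinuousOn (fun t => b t k) (Set.Icc 0 t₁))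
    (ha : ∀ t ∈ Set.Icc 0 t₁, ∀ k, ‖a t k‖ ≤ Ma * Real.exp (-σ * freqNorm k))
    (hb : ∀ t ∈ Set.Icc 0 t₁, ∀ k, ‖b t k‖ ≤ Mb * Real.exp (-σ * freqNorm k))
    (had : ∀ t ∈ Set.Ioo 0 t₁, ∀ k, HasDerivAt (fun s => a s k)
      (-transport T (a t) (a t) k - κ * (freqNorm k ^ γ : ℝ) * a t k + g k) t)
    (hbd : ∀ t ∈ Set.Ioo 0 t₁, ∀ k, HasDerivAt (fun s => b s k)
      (-transport T (b t) (b t) k + g k) t)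
    (hab : a 0 = b 0)
    (hbB : ∀ t ∈ Set.Icc 0 t₁, wienerNorm 2 τ₀ (b t) ≤ ENNReal.ofReal B)
    (hbA : ∀ t ∈ Set.Icc 0 t₁, wienerNorm (1 + γ) τ₀ (b t) ≤ ENNReal.ofReal A)
    (hsmall : κ * A * t₁ < 1) {t : ℝ} (ht : t ∈ Set.Icc 0 t₁) :
    wienerNorm 1 (τ₀ - lam * t) (a t - b t) ≤ ENNReal.ofReal (κ * A * t) := by
  have hlam0 : 0 ≤ lam := by rw [hlam]; positivity
  have hτs : ∀ s ∈ Set.Icc 0 t₁, τ₀ - lam * s ≤ τ₀ := fun s hs => by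
    linarith [mul_nonneg hlam0 hs.1]
  have step := fun {t : ℝ} (ht : t ∈ Set.Icc 0 t₁) => wienerNorm_sub_le_of_le_one hκ hγ hσ hτσ hC0
    hC hB hA hlam hτ₀ hac hbc ha hb had hbd hab hbB hbA ht
  set Y : ℝ → ℝ := fun s =>
    ∑' k, freqNorm k ^ (1 : ℝ) * Real.exp ((τ₀ - lam * s) * freqNorm k) * ‖(a s - b s) k‖ with hY
  have hYW : ∀ s ∈ Set.Icc 0 t₁, wienerNorm 1 (τ₀ - lam * s) (a s - b s) = ENNReal.ofReal (Y s) :=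
    fun s hs => wienerNorm_eq_ofReal_tsum ((hτs s hs).trans_lt hτσ) zero_le_one
      (norm_sub_le_of_decay (ha s hs) (hb s hs))
  have hYc : ContinuousOn Y (Set.Icc 0 t₁) := by
    refine continuousOn_tsum (u := fun k => (Ma + Mb) *
      (freqNorm k ^ (1 : ℝ) * Real.exp (-(σ - τ₀) * freqNorm k))) (fun k => ?_)
      ((summable_rpow_mul_exp_neg zero_le_one (sub_pos.mpr hτσ)).mul_left _) fun k s hs => ?_
    · exact ((by fun_prop : Continuous fun s : ℝ => freqNorm k ^ (1 : ℝ) *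
        Real.exp ((τ₀ - lam * s) * freqNorm k)).continuousOn).mul ((hac k).sub (hbc k)).norm
    · rw [Real.norm_of_nonneg (mul_nonneg (weight_nonneg _ _ _) (norm_nonneg _))]
      have h1 := norm_sub_le_of_decay (ha s hs) (hb s hs) k
      have h2 : Real.exp ((τ₀ - lam * s) * freqNorm k) ≤ Real.exp (τ₀ * freqNorm k) :=
        Real.exp_le_exp.mpr (mul_le_mul_of_nonneg_right (hτs s hs) (freqNorm_nonneg k))
      have h3 : 0 ≤ freqNorm k ^ (1 : ℝ) := Real.rpow_nonneg (freqNorm_nonneg k) _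
      calc _ ≤ freqNorm k ^ (1 : ℝ) * Real.exp (τ₀ * freqNorm k) *
            ((Ma + Mb) * Real.exp (-σ * freqNorm k)) := by gcongr
        _ = _ := by
          rw [show -(σ - τ₀) * freqNorm k = τ₀ * freqNorm k + -σ * freqNorm k by ring,
            Real.exp_add]
          ring
  have hlt : ∀ s ∈ Set.Icc 0 t₁, Y s < 1 := by
    by_contra! hcon
    obtain ⟨s₁, hs₁, hs₁Y⟩ := hcon
    have hcpt : IsCompact (Set.Icc 0 t₁ ∩ Y ⁻¹' Set.Ici 1) :=
      isCompact_Icc.of_isClosed_subset (hYc.preimage_isClosed_of_isClosed isClosed_Icc isClosed_Ici)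
        Set.inter_subset_left
    obtain ⟨s, ⟨hs, hsY⟩, hmin⟩ := hcpt.exists_isLeast ⟨s₁, hs₁, hs₁Y⟩
    have hW := step hs fun r hr => by
      have hrI : r ∈ Set.Icc 0 t₁ := ⟨hr.1.le, hr.2.le.trans hs.2⟩
      rw [hYW r hrI, ENNReal.ofReal_le_one]
      by_contra! hr1
      exact absurd (hmin ⟨hrI, hr1.le⟩) (not_le.mpr hr.2)
    have h0 : 0 ≤ κ * A := mul_nonneg hκ hA
    rw [hYW s hs, ENNReal.ofReal_le_ofReal_iff (mul_nonneg h0 hs.1)] at hW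
    have := mul_le_mul_of_nonneg_left hs.2 h0
    have hsY' : 1 ≤ Y s := hsY
    linarith
  refine step ht fun s hs => ?_
  have hsI : s ∈ Set.Icc 0 t₁ := ⟨hs.1.le, hs.2.le.trans ht.2⟩
  rw [hYW s hsI, ENNReal.ofReal_le_one]
  exact (hlt s hsI).le

end Stability

/-! ### The inviscid limit -/

/-- A Wiener bound at radius `τ + δ` controls all analytic Sobolev norms at radius `τ`. -/
lemma analyticNorm_le_of_wienerNorm_le {r τ δ η : ℝ} (hη : 0 ≤ η)
    {f : (Fin d → ℝ) → ℝ} (h : wienerNorm 1 (τ + δ) (coeff f) ≤ ENNReal.ofReal η) :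
    analyticNorm r τ f ≤ ENNReal.ofReal η *
      (∑' k : Fin d → ℤ, ENNReal.ofReal
        (freqNorm k ^ (2 * r) * Real.exp (-(2 * δ) * freqNorm k))) ^ (1 / 2 : ℝ) := by
  have hpt : ∀ k : Fin d → ℤ, k ≠ 0 → Real.exp ((τ + δ) * freqNorm k) * ‖coeff f k‖ ≤ η := by
    intro k hk
    have h1 := (ENNReal.le_tsum k).trans h
    rw [ofReal_mul_enorm (weight_nonneg _ _ _), ENNReal.ofReal_le_ofReal_iff hη,
      Real.rpow_one] at h1
    refine le_trans (mul_le_mul_of_nonneg_right ?_ (norm_nonneg _)) h1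
    exact le_mul_of_one_le_left (Real.exp_pos _).le (one_le_freqNorm hk)
  have hη2 : ENNReal.ofReal η = ENNReal.ofReal (η ^ 2) ^ (1 / 2 : ℝ) := by
    rw [ENNReal.ofReal_rpow_of_nonneg (sq_nonneg η) (by norm_num), ← Real.sqrt_eq_rpow,
      Real.sqrt_sq hη]
  rw [hη2, ← ENNReal.mul_rpow_of_nonneg _ _ (by norm_num : (0 : ℝ) ≤ 1 / 2),
    ← ENNReal.tsum_mul_left]
  refine ENNReal.rpow_le_rpow ?_ (by norm_num)
  refine le_trans (ENNReal.tsum_le_tsum fun k => ?_) (ENNReal.tsum_comp_le_tsum_of_injective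
    (f := ((↑) : {k : Fin d → ℤ // k ≠ 0} → Fin d → ℤ)) Subtype.val_injective _)
  rw [← ENNReal.ofReal_mul (sq_nonneg η)]
  refine ENNReal.ofReal_le_ofReal ?_
  have h2 := pow_le_pow_left₀ (by positivity) (hpt k.1 k.2) 2
  have e : freqNorm k.1 ^ (2 * r) * Real.exp (2 * τ * freqNorm k.1) * ‖coeff f k.1‖ ^ 2 =
      (Real.exp ((τ + δ) * freqNorm k.1) * ‖coeff f k.1‖) ^ 2 *
        (freqNorm k.1 ^ (2 * r) * Real.exp (-(2 * δ) * freqNorm k.1)) := by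
    rw [show 2 * τ * freqNorm k.1 = (2 : ℕ) * ((τ + δ) * freqNorm k.1) + -(2 * δ) * freqNorm k.1 by
      push_cast; ring, Real.exp_add, Real.exp_nat_mul]
    ring
  rw [e]
  exact mul_le_mul_of_nonneg_right h2 (weight_nonneg _ _ _)

/-- Inviscid limit in the Wiener norm, on a time interval and with a rate of loss of analyticity
that do not depend on the diffusivity. -/
lemma exists_wienerNorm_sub_le {T : Fin d → Fin d → (Fin d → ℤ) → ℂ} (hT : IsAdmissible T)
    {γ : ℝ} (hγ : 0 < γ) {θ₀ S : (Fin d → ℝ) → ℝ} (hS : Continuous S) {Tbar τbar : ℝ}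
    (hTbar : 0 < Tbar) (hτbar : 0 < τbar) {θ : ℝ → ℝ → (Fin d → ℝ) → ℝ}
    (hθ : ∀ κ : ℝ, 0 ≤ κ → IsAnalyticSolution T γ κ θ₀ S Tbar τbar (θ κ)) :
    ∃ lam A t₁ : ℝ, 0 < lam ∧ 0 ≤ A ∧ 0 < t₁ ∧ t₁ ≤ Tbar ∧ lam * t₁ ≤ τbar / 8 ∧
      ∀ κ : ℝ, 0 ≤ κ → κ * A * t₁ < 1 → ∀ t ∈ Set.Icc 0 t₁,
        wienerNorm 1 (τbar / 2 - lam * t) (coeff fun x => θ κ t x - θ 0 t x) ≤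
          ENNReal.ofReal (κ * A * t) := by
  obtain ⟨C₀, hC₀, hC⟩ := hT.exists_bound
  have hσ : 0 < 3 * τbar / 4 := by linarith
  have hστ : 3 * τbar / 4 < τbar := by linarith
  have hτσ : τbar / 2 < 3 * τbar / 4 := by linarith
  obtain ⟨M, hM⟩ := (hθ 0 le_rfl).exists_decay hσ hστ
  have hM0 : 0 ≤ M := nonneg_of_decay (hM 0 ⟨le_rfl, hTbar.le⟩)
  set G : ℝ → ℝ := fun s => ∑' k : Fin d → ℤ,
    M * (freqNorm k ^ s * Real.exp (-(3 * τbar / 4 - τbar / 2) * freqNorm k)) with hG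
  have hG0 : ∀ s, 0 ≤ G s := fun s => tsum_nonneg fun k => mul_nonneg hM0 (weight_nonneg _ _ _)
  -- The summand `1` makes the loss rate positive even when `d * (d * C₀) = 0`.
  set C : ℝ := d * (d * C₀) + 1 with hCdef
  have hCpos : 0 < C := by positivity
  have hCi : ∀ m n, ‖interaction T m n‖ ≤ C * (freqNorm m * freqNorm n) := fun m n =>
    (norm_interaction_le hC m n).trans (mul_le_mul_of_nonneg_right (by simp [hCdef])
      (mul_nonneg (freqNorm_nonneg _) (freqNorm_nonneg _)))
  set lam : ℝ := C * (2 + 4 * G 2) with hlam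
  have hlam0 : 0 < lam := mul_pos hCpos (by linarith [hG0 2])
  set t₁ : ℝ := min Tbar (τbar / 8 / lam) with ht₁
  have ht₁0 : 0 < t₁ := lt_min hTbar (by positivity)
  have ht₁T : t₁ ≤ Tbar := min_le_left _ _
  have hlt : lam * t₁ ≤ τbar / 8 := by
    rw [mul_comm, ← le_div_iff₀ hlam0]
    exact min_le_right _ _
  have hsub : Set.Icc 0 t₁ ⊆ Set.Icc 0 Tbar := Set.Icc_subset_Icc_right ht₁T
  refine ⟨lam, G (1 + γ), t₁, hlam0, hG0 _, ht₁0, ht₁T, hlt, fun κ hκ hsmall t ht => ?_⟩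
  obtain ⟨Mκ, hMκ⟩ := (hθ κ hκ).exists_decay hσ hστ
  have e : (coeff fun x => θ κ t x - θ 0 t x) = coeff (θ κ t) - coeff (θ 0 t) := by
    ext k
    exact coeff_sub ((hθ κ hκ).continuous t (hsub ht)) ((hθ 0 le_rfl).continuous t (hsub ht)) k
  rw [e]
  refine wienerNorm_sub_le (a := fun t => coeff (θ κ t)) (b := fun t => coeff (θ 0 t))
    (g := coeff S) hκ hγ hσ hτσ hCpos.le hCi (hG0 2) (hG0 (1 + γ)) hlam (by linarith)
    (fun k => ((hθ κ hκ).continuousOn_coeff hT hγ.le hκ hS hτbar k).mono hsub)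
    (fun k => ((hθ 0 le_rfl).continuousOn_coeff hT hγ.le le_rfl hS hτbar k).mono hsub)
    (fun t ht => hMκ t (hsub ht)) (fun t ht => hM t (hsub ht))
    (fun t ht k => (hθ κ hκ).hasDerivAt_coeff hT hγ.le hκ hS hτbar
      ⟨ht.1, ht.2.trans_le ht₁T⟩ k)
    (fun t ht k => ((hθ 0 le_rfl).hasDerivAt_coeff hT hγ.le le_rfl hS hτbar
      ⟨ht.1, ht.2.trans_le ht₁T⟩ k).congr_deriv (by simp))
    ?_ (fun t ht => wienerNorm_le_of_decay hτσ zero_le_two (hM t (hsub ht)))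
    (fun t ht => wienerNorm_le_of_decay hτσ (by linarith) (hM t (hsub ht))) hsmall ht
  simp only [show θ κ 0 = θ 0 0 from
    funext fun x => ((hθ κ hκ).initial x).trans ((hθ 0 le_rfl).initial x).symm]

end ActiveScalar

end

theorem theorem2p2 (d : ℕ) (hd : 2 ≤ d)
    (T : Fin d → Fin d → (Fin d → ℤ) → ℂ) (hT : ActiveScalar.IsAdmissible T)
    (γ : ℝ) (hγ : γ ∈ Set.Ioc (0 : ℝ) 2)
    (θ₀ S : (Fin d → ℝ) → ℝ)
    (hθ₀ : ActiveScalar.IsAnalytic θ₀) (hθ₀_mean : ActiveScalar.MeanZero θ₀)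
    (hS : ActiveScalar.IsAnalytic S) (hS_mean : ActiveScalar.MeanZero S)
    (Tbar τbar : ℝ) (hTbar : 0 < Tbar) (hτbar : 0 < τbar)
    (θ : ℝ → ℝ → (Fin d → ℝ) → ℝ)
    (hθ : ∀ κ : ℝ, 0 ≤ κ →
      ActiveScalar.IsAnalyticSolution T γ κ θ₀ S Tbar τbar (θ κ)) :
    ∃ T₁ : ℝ, 0 < T₁ ∧ T₁ ≤ Tbar ∧
      ∃ τ : ℝ → ℝ, ContinuousOn τ (Set.Icc 0 T₁) ∧ StrictAntiOn τ (Set.Icc 0 T₁) ∧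
        (∀ t ∈ Set.Icc 0 T₁, 0 < τ t ∧ τ t < τbar) ∧
        ∀ r : ℝ, (d : ℝ) / 2 + 5 / 2 < r →
          ∀ t ∈ Set.Icc 0 T₁,
            Filter.Tendsto
              (fun κ : ℝ => ActiveScalar.analyticNorm r (τ t) (fun x => θ κ t x - θ 0 t x))
              (nhdsWithin 0 (Set.Ioi 0)) (nhds 0) := by
  obtain ⟨lam, A, t₁, hlam, hA, ht₁, ht₁T, hlt, hmain⟩ :=
    ActiveScalar.exists_wienerNorm_sub_le hT hγ.1 hS.2.1 hTbar hτbar hθ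
  -- A quarter of `τbar` is given up to pass from the Wiener norm to all Sobolev exponents `r`.
  refine ⟨t₁, ht₁, ht₁T, fun t => τbar / 4 - lam * t, by fun_prop, ?_, ?_, ?_⟩
  · intro s _ t _ hst
    have := mul_lt_mul_of_pos_left hst hlam
    simp only
    linarith
  · intro t ht
    have h1 := mul_le_mul_of_nonneg_left ht.2 hlam.le
    have h2 := mul_nonneg hlam.le ht.1
    constructor <;> linarith
  · intro r hr t ht
    have hr0 : 0 ≤ 2 * r := by
      have : (0 : ℝ) ≤ d := Nat.cast_nonneg d
      linarith
    set K : ENNReal := (∑' k : Fin d → ℤ, ENNReal.ofReal (ActiveScalar.freqNorm k ^ (2 * r) *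
      Real.exp (-(2 * (τbar / 4)) * ActiveScalar.freqNorm k))) ^ (1 / 2 : ℝ) with hK
    have hKfin : K ≠ ⊤ := ENNReal.rpow_ne_top_of_nonneg (by norm_num)
      (ActiveScalar.summable_rpow_mul_exp_neg hr0 (by linarith)).tsum_ofReal_ne_top
    have hzero : Filter.Tendsto (fun κ : ℝ => ENNReal.ofReal (κ * A * t) * K)
        (nhdsWithin 0 (Set.Ioi 0)) (nhds 0) := by
      have h1 : Filter.Tendsto (fun κ : ℝ => ENNReal.ofReal (κ * A * t))
          (nhdsWithin 0 (Set.Ioi 0)) (nhds 0) := by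
        have h2 : Continuous fun κ : ℝ => ENNReal.ofReal (κ * A * t) :=
          ENNReal.continuous_ofReal.comp (by fun_prop)
        simpa using (h2.tendsto 0).mono_left nhdsWithin_le_nhds
      simpa using ENNReal.Tendsto.mul_const h1 (Or.inr hKfin)
    have hsmall : ∀ᶠ κ : ℝ in nhdsWithin 0 (Set.Ioi 0), κ * A * t₁ < 1 := by
      have h2 : Continuous fun κ : ℝ => κ * A * t₁ := by fun_prop
      exact ((h2.tendsto 0).mono_left nhdsWithin_le_nhds).eventually_lt_const (by simp)
    refine tendsto_of_tendsto_of_tendsto_of_le_of_le' tendsto_const_nhds hzero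
      (Filter.Eventually.of_forall fun _ => zero_le) ?_
    filter_upwards [hsmall, self_mem_nhdsWithin] with κ hκ hκ0
    have hκ0' : (0 : ℝ) ≤ κ := le_of_lt hκ0
    refine ActiveScalar.analyticNorm_le_of_wienerNorm_le
      (mul_nonneg (mul_nonneg hκ0' hA) ht.1) ?_
    rw [show τbar / 4 - lam * t + τbar / 4 = τbar / 2 - lam * t by ring]
    exact hmain κ hκ0' hκ t ht
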